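/- Consider the following problem. Given are a ground set $E$ with $n$ elements, a non-negative, not necessarily monotone, submodular function $f:2^E\to\mathbb{R}_{\ge 0}$ (i.e. $f(S)+f(T)\ge f(S\cup T)+f(S\cap T)$ for all $S,T\subseteq E$), a $p$-system $\mathcal I\subseteq 2^E$ with an integer $p\ge 1$ (i.e. $\emptyset\in\mathcal I$, $\mathcal I$ is closed under taking subsets, and for every $A\subseteq E$ any two inclusion-maximal members $B,B'$ of $\{S\in\mathcal I: S\subseteq A\}$ satisfy $|B|\le p|B'|$), and $d\ge 0$ knapsack constraints with costs $c_i:E\to\mathbb{R}_{\ge 0}$, $1\le i\le d$. A set $S\subseteq E$ is feasible if $S\in\mathcal I$ and $\sum_{e\in S}c_i(e)\le 1$ for all $i$. The task is to maximize $f(S)$ over the feasible sets $S$; let $\mathrm{OPT}$ be the maximum and let $r$ be the size of the largest feasible set. An algorithm is given $E$, $p$, $d$, the costs $c_i$ and $\varepsilon$ explicitly, while $f$ and $\mathcal I$ are accessible only through a value oracle (returning $f(S)$ for a queried set $S$) and an independence oracle (telling whether a queried set $S$ is in $\mathcal I$). Its complexity is the total number of queries to both oracles. There are a deterministic adaptive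 algorithm and an absolute constant $K$ such that, for every instance as above and every $\varepsilon\in(0,1)$, the algorithm returns a feasible set $S$ with $$f(S)\ \ge\ \Big(\frac{p}{(p+1)(2p+2d+1)}-\varepsilon\Big)\,\mathrm{OPT}$$ and makes at most $$K\cdot n\cdot\max\{r,1\}\cdot p\cdot\max\Big\{\log\frac1\varepsilon,\ \log\log n\Big\}$$ value and independence oracle queries in total (where $\log\log n$ is read as $0$ for $n\le 1$). In particular, if some non-empty set is feasible, the number of queries is $O\big(nrp\max\{\log\frac1\varepsilon,\log\log n\}\big)$. -/

import Mathlib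

/-- A set function on the subsets of a finite ground set is submodular. -/
def IsSubmodular {E : Type*} [DecidableEq E] (f : Finset E → ℝ) : Prop :=
  ∀ S T : Finset E, f (S ∪ T) + f (S ∩ T) ≤ f S + f T

/-- `B` is a base of `A`: an inclusion-maximal independent subset of `A`. -/
def IsBaseOf {E : Type*} (Indep : Finset E → Prop) (A B : Finset E) : Prop :=
  Maximal (fun S : Finset E => S ⊆ A ∧ Indep S) B

/-- The family of independent sets is a `p`-system: it contains the empty set, it is closed under
taking subsets, and for every subset `A` of the ground set the sizes of any two bases of `A` differ
by a factor of at most `p`. -/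
structure IsPSystem {E : Type*} (p : ℕ) (Indep : Finset E → Prop) : Prop where
  empty : Indep ∅
  subset : ∀ S T : Finset E, Indep T → S ⊆ T → Indep S
  card_le : ∀ A B B' : Finset E, IsBaseOf Indep A B → IsBaseOf Indep A B' → B.card ≤ p * B'.card

/-- Feasibility for the intersection of an independence family with `d` knapsack constraints:
`c i e` is the cost of the element `e` in the `i`-th knapsack, and all capacities are `1`. -/
def IsFeasible {E : Type*} {d : ℕ} (Indep : Finset E → Prop) (c : Fin d → E → ℝ)
    (S : Finset E) : Prop :=
  Indep S ∧ ∀ i : Fin d, ∑ e ∈ S, c i e ≤ 1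

/-- The size of the largest feasible set. -/
noncomputable def maxFeasibleCard {E : Type*} [Fintype E] {d : ℕ} (Indep : Finset E → Prop)
    (c : Fin d → E → ℝ) : ℕ :=
  open Classical in ((Finset.univ : Finset (Finset E)).filter (IsFeasible Indep c)).sup Finset.card

/-- A deterministic adaptive algorithm with access to a value oracle and to an independence oracle
for subsets of `E`, as a decision tree. It either stops with an output set, or queries the value of
a set and continues depending on the real number that it receives, or asks whether a set is
independent and continues depending on the answer. -/
inductive OracleAlg (E : Type*) where
  | output (S : Finset E) : OracleAlg E
  | valueQuery (S : Finset E) (next : ℝ → OracleAlg E) : OracleAlg E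
  | indepQuery (S : Finset E) (next : Bool → OracleAlg E) : OracleAlg E

namespace OracleAlg

/-- The set returned by the algorithm when the value oracle is `f` and the independence oracle
is `Indep`. -/
noncomputable def result {E : Type*} (f : Finset E → ℝ) (Indep : Finset E → Prop) :
    OracleAlg E → Finset E
  | output S => S
  | valueQuery S next => result f Indep (next (f S))
  | indepQuery S next => result f Indep (next (open Classical in decide (Indep S)))

/-- The total number of oracle queries, of both kinds, made by the algorithm when the value oracle
is `f` and the independence oracle is `Indep`. -/
noncomputable def queryCount {E : Type*} (f : Finset E → ℝ) (Indep : Finset E → Prop) :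
    OracleAlg E → ℕ
  | output _ => 0
  | valueQuery S next => queryCount f Indep (next (f S)) + 1
  | indepQuery S next => queryCount f Indep (next (open Classical in decide (Indep S))) + 1

end OracleAlg

/-! The algorithm combines a density-threshold greedy, disjoint repetitions, deterministic
unconstrained maximization and a binary search for the threshold. Write M for the best value found.

One greedy run with threshold ρ adds the best independent element whose marginal is at least ρ times
its total cost. If the best candidate overflows a knapsack, the density bound forces ρ ≤ f(S) +
f({x}) ≤ 2M. Otherwise every feasible T satisfies f(S ∪ T) ≤ (p+1) f(S) + dρ: dense elements of T
were rejected by independence and are charged to S, at most p per element (`GreedyInvariant`), while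
sparse ones contribute at most ρ times the total cost of T, which is at most d.

Without monotonicity f(S ∪ T) may be small. So p+1 runs are made on disjoint ground sets, and
submodularity turns the sum of the values f(S_i ∪ T_i) into a bound on p·f(T), up to the values
f(S_i ∩ T_i) (`repeated_bound_step`). These are at most 2M because a derandomized double greedy,
using O(r²) queries, is run on each S_i. Hence p·f(T) ≤ (p+1)((2p+1)M + dρ) when no run overflows
(`OptBound`).

The search looks for adjacent thresholds, with ratio 1+ε, such that the lower one satisfies ρ ≤ 2M
and the upper one satisfies `OptBound`; together they give the ratio. The grid spans a factor of
about n, so it has O(log n / ε) points, and bisection needs O(log(log n / ε)) threshold tests of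
O(nrp) queries each. -/

/-! ### Query programs and their cost calculus. -/

/-- Query programs returning a value of type `α`: the free monad over the value oracle and the
independence oracle. -/
inductive QueryProg (E : Type) (α : Type) where
  | ret (a : α) : QueryProg E α
  | value (S : Finset E) (next : ℝ → QueryProg E α) : QueryProg E α
  | indep (S : Finset E) (next : Bool → QueryProg E α) : QueryProg E α

namespace QueryProg

variable {E α β : Type}

/-- Sequential composition. -/
def bind (m : QueryProg E α) (g : α → QueryProg E β) : QueryProg E β :=
  match m with
  | ret a => g a
  | value S next => value S fun v => (next v).bind g
  | indep S next => indep S fun v => (next v).bind g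

/-- The decision tree of a query program that returns a set. -/
def toAlg : QueryProg E (Finset E) → OracleAlg E
  | ret S => .output S
  | value S next => .valueQuery S fun v => (next v).toAlg
  | indep S next => .indepQuery S fun v => (next v).toAlg

/-- Run on the oracles `f` and `Indep`, the program makes at most `k` queries and returns a value
that satisfies `Q`. -/
def Yields (f : Finset E → ℝ) (Indep : Finset E → Prop) :
    QueryProg E α → ℕ → (α → Prop) → Prop
  | ret a, _, Q => Q a
  | value S next, k, Q => ∃ j, j + 1 ≤ k ∧ Yields f Indep (next (f S)) j Q
  | indep S next, k, Q =>
      ∃ j, j + 1 ≤ k ∧ Yields f Indep (next (open Classical in decide (Indep S))) j Q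

variable {f : Finset E → ℝ} {Indep : Finset E → Prop}

theorem Yields.mono {m : QueryProg E α} {k k' : ℕ} {Q Q' : α → Prop}
    (h : m.Yields f Indep k Q) (hk : k ≤ k') (hQ : ∀ a, Q a → Q' a) :
    m.Yields f Indep k' Q' := by
  induction m generalizing k k' with
  | ret a => exact hQ a h
  | value S next ih =>
    obtain ⟨j, hj, h⟩ := h
    exact ⟨j, hj.trans hk, ih _ h le_rfl⟩
  | indep S next ih =>
    obtain ⟨j, hj, h⟩ := h
    exact ⟨j, hj.trans hk, ih _ h le_rfl⟩

theorem Yields.bind {m : QueryProg E α} {g : α → QueryProg E β} {k k' : ℕ} {Q : α → Prop}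
    {R : β → Prop} (h : m.Yields f Indep k Q) (hg : ∀ a, Q a → (g a).Yields f Indep k' R) :
    (m.bind g).Yields f Indep (k + k') R := by
  induction m generalizing k with
  | ret a => exact (hg a h).mono (Nat.le_add_left _ _) fun _ => id
  | value S next ih =>
    obtain ⟨j, hj, h⟩ := h
    exact ⟨j + k', by omega, ih _ h⟩
  | indep S next ih =>
    obtain ⟨j, hj, h⟩ := h
    exact ⟨j + k', by omega, ih _ h⟩

theorem Yields.toAlg {m : QueryProg E (Finset E)} {k : ℕ} {Q : Finset E → Prop}
    (h : m.Yields f Indep k Q) :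
    Q (m.toAlg.result f Indep) ∧ m.toAlg.queryCount f Indep ≤ k := by
  induction m generalizing k with
  | ret a => exact ⟨h, Nat.zero_le _⟩
  | value S next ih =>
    obtain ⟨j, hj, h⟩ := h
    obtain ⟨h1, h2⟩ := ih _ h
    exact ⟨h1, (Nat.succ_le_succ h2).trans hj⟩
  | indep S next ih =>
    obtain ⟨j, hj, h⟩ := h
    obtain ⟨h1, h2⟩ := ih _ h
    exact ⟨h1, (Nat.succ_le_succ h2).trans hj⟩

variable [DecidableEq E]

/-- Query the values of all sets of a list. -/
def askValueList : List (Finset E) → QueryProg E (Finset E → ℝ)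
  | [] => ret fun _ => 0
  | S :: L => value S fun v => (askValueList L).bind fun g => ret (Function.update g S v)

/-- Query the independence of all sets of a list. -/
def askIndepList : List (Finset E) → QueryProg E (Finset E → Bool)
  | [] => ret fun _ => false
  | S :: L => indep S fun v => (askIndepList L).bind fun g => ret (Function.update g S v)

theorem yields_askValueList (L : List (Finset E)) :
    (askValueList L).Yields f Indep L.length fun g => ∀ T ∈ L, g T = f T := by
  induction L with
  | nil => intro T hT; cases hT
  | cons S L ih =>
    refine ⟨L.length + 0, by simp, ih.bind fun g hg T hT => ?_⟩
    by_cases hTS : T = S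
    · subst hTS; simp
    · rw [Function.update_of_ne hTS]
      exact hg T ((List.mem_cons.1 hT).resolve_left hTS)

theorem yields_askIndepList (L : List (Finset E)) :
    (askIndepList L).Yields f Indep L.length fun g => ∀ T ∈ L, (g T = true ↔ Indep T) := by
  induction L with
  | nil => intro T hT; cases hT
  | cons S L ih =>
    refine ⟨L.length + 0, by simp, ih.bind fun g hg T hT => ?_⟩
    by_cases hTS : T = S
    · subst hTS; simp
    · rw [Function.update_of_ne hTS]
      exact hg T ((List.mem_cons.1 hT).resolve_left hTS)

/-- Query the values of all sets of a finite family. -/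
noncomputable def askValues (F : Finset (Finset E)) : QueryProg E (Finset E → ℝ) :=
  askValueList F.toList

/-- Query the independence of all sets of a finite family. -/
noncomputable def askIndep (F : Finset (Finset E)) : QueryProg E (Finset E → Bool) :=
  askIndepList F.toList

theorem yields_askValues (F : Finset (Finset E)) :
    (askValues F).Yields f Indep F.card fun g => ∀ T ∈ F, g T = f T :=
  (yields_askValueList F.toList).mono (by simp) fun g hg T hT => hg T (by simpa using hT)

theorem yields_askIndep (F : Finset (Finset E)) :
    (askIndep F).Yields f Indep F.card fun g => ∀ T ∈ F, (g T = true ↔ Indep T) :=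
  (yields_askIndepList F.toList).mono (by simp) fun g hg T hT => hg T (by simpa using hT)

end QueryProg

/-- An element of a finite set at which a function is maximal, if there is one. -/
noncomputable def Finset.argmax? {α : Type} (F : Finset α) (w : α → ℝ) : Option α :=
  open Classical in
  if h : F.Nonempty then some (F.exists_max_image w h).choose else none

theorem Finset.argmax?_eq_none {α : Type} {F : Finset α} {w : α → ℝ} (h : F.argmax? w = none) :
    F = ∅ := by
  unfold Finset.argmax? at h
  split_ifs at h with h1
  exact Finset.not_nonempty_iff_eq_empty.1 h1

theorem Finset.argmax?_eq_some {α : Type} {F : Finset α} {w : α → ℝ} {x : α}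
    (h : F.argmax? w = some x) : x ∈ F ∧ ∀ y ∈ F, w y ≤ w x := by
  unfold Finset.argmax? at h
  split_ifs at h with h1
  cases h
  exact (F.exists_max_image w h1).choose_spec

namespace QueryProg

variable {E : Type} [DecidableEq E] {f : Finset E → ℝ} {Indep : Finset E → Prop}

/-- Query the values of the sets of a finite family and return a best one (the empty set if the
family is empty). -/
noncomputable def best (F : Finset (Finset E)) : QueryProg E (Finset E) :=
  (askValues F).bind fun g => ret ((F.argmax? g).getD ∅)

theorem yields_best {F : Finset (Finset E)} (hF : F.Nonempty) :
    (best F).Yields f Indep F.card fun S => S ∈ F ∧ ∀ T ∈ F, f T ≤ f S := by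
  refine ((yields_askValues F).bind (k' := 0) fun g hg => ?_).mono le_rfl fun _ => id
  rcases h : F.argmax? g with _ | x
  · exact absurd (Finset.argmax?_eq_none h) hF.ne_empty
  · obtain ⟨h1, h2⟩ := Finset.argmax?_eq_some h
    exact ⟨h1, fun T hT => by simpa [hg T hT, hg x h1] using h2 T hT⟩

end QueryProg

/-! ### Coin biases with few random coins. -/

/-- A point of the unit cube can be moved to one with at most two fractional coordinates without
changing the values of two given linear forms. -/
theorem exists_card_fractional_le_two {ι : Type} (s : Finset ι) (a b z : ι → ℝ)
    (hz : ∀ i ∈ s, 0 ≤ z i ∧ z i ≤ 1) :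
    ∃ y : ι → ℝ, (∀ i ∈ s, 0 ≤ y i ∧ y i ≤ 1) ∧ ∑ i ∈ s, a i * y i = ∑ i ∈ s, a i * z i ∧
      ∑ i ∈ s, b i * y i = ∑ i ∈ s, b i * z i ∧
      (s.filter fun i => y i ≠ 0 ∧ y i ≠ 1).card ≤ 2 := by
  classical
  induction hN : (s.filter fun i => z i ≠ 0 ∧ z i ≠ 1).card using Nat.strong_induction_on
    generalizing z with
  | _ N ih =>
  by_cases hN2 : N ≤ 2
  · exact ⟨z, hz, rfl, rfl, hN.trans_le hN2⟩
  set F := s.filter fun i => z i ≠ 0 ∧ z i ≠ 1 with hF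
  let φ : (F → ℝ) →ₗ[ℝ] ℝ × ℝ :=
    LinearMap.prod (∑ i : F, a i • LinearMap.proj i) (∑ i : F, b i • LinearMap.proj i)
  have hker : LinearMap.ker φ ≠ ⊥ := by
    -- At least three fractional coordinates against two linear forms leave a nonzero direction
    -- along which both forms are constant.
    apply LinearMap.ker_ne_bot_of_finrank_lt
    simp [hN]
    omega
  obtain ⟨v, hv, hv0⟩ := Submodule.exists_mem_ne_zero_of_ne_bot hker
  let x : ι → ℝ := fun i => if h : i ∈ F then v ⟨i, h⟩ else 0
  have hsum : ∀ c : ι → ℝ, ∑ i ∈ s, c i * x i = ∑ i : F, c i * v i := by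
    intro c
    rw [Finset.univ_eq_attach, ← Finset.sum_subset (Finset.filter_subset _ s : F ⊆ s),
      ← Finset.sum_attach F]
    · exact Finset.sum_congr rfl fun i _ => by simp [x]
    · intro i _ hi
      rw [show x i = 0 from dif_neg hi, mul_zero]
  have hva : ∑ i ∈ s, a i * x i = 0 := by
    rw [hsum]
    simpa [φ] using congrArg Prod.fst hv
  have hvb : ∑ i ∈ s, b i * x i = 0 := by
    rw [hsum]
    simpa [φ] using congrArg Prod.snd hv
  have hfr : ∀ i ∈ F, 0 < z i ∧ z i < 1 := by
    intro i hi
    obtain ⟨his, h0, h1⟩ := Finset.mem_filter.1 hi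
    exact ⟨lt_of_le_of_ne (hz i his).1 h0.symm, lt_of_le_of_ne (hz i his).2 h1⟩
  have hxF : ∀ i, i ∉ F → x i = 0 := fun i hi => by simp [x, hi]
  let G := F.filter fun i => x i ≠ 0
  have hG : G.Nonempty := by
    by_contra hne
    apply hv0
    ext ⟨i, hi⟩
    by_contra hvi
    exact hne ⟨i, Finset.mem_filter.2 ⟨hi, by simpa [x, hi] using hvi⟩⟩
  -- The step length at which coordinate `i` reaches a face of the cube; the smallest one keeps the
  -- point inside and makes coordinate `k` integral.
  let t : ι → ℝ := fun i => if 0 < x i then (1 - z i) / x i else -z i / x i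
  obtain ⟨k, hk, hmin⟩ := G.exists_min_image t hG
  have htpos : ∀ i ∈ G, 0 < t i := by
    intro i hi
    obtain ⟨hiF, hi0⟩ := Finset.mem_filter.1 hi
    obtain ⟨h0, h1⟩ := hfr i hiF
    simp only [t]
    split_ifs with hpos
    · exact div_pos (by linarith) hpos
    · exact div_pos_of_neg_of_neg (by linarith) (lt_of_le_of_ne (not_lt.1 hpos) hi0)
  have hbd : ∀ i ∈ s, 0 ≤ z i + t k * x i ∧ z i + t k * x i ≤ 1 := by
    intro i his
    by_cases hi : i ∈ G
    · obtain ⟨hiF, hi0⟩ := Finset.mem_filter.1 hi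
      obtain ⟨h0, h1⟩ := hfr i hiF
      have hk0 := htpos k hk
      have hle := hmin i hi
      simp only [t] at hle hk0
      by_cases hpos : 0 < x i
      · rw [if_pos hpos, le_div_iff₀ hpos] at hle
        simp only [t]
        exact ⟨by positivity, by linarith⟩
      · have hneg : x i < 0 := lt_of_le_of_ne (not_lt.1 hpos) hi0
        rw [if_neg hpos, le_div_iff_of_neg hneg] at hle
        have := mul_neg_of_pos_of_neg hk0 hneg
        simp only [t]
        exact ⟨by linarith, by linarith⟩
    · have hx0 : x i = 0 := by
        by_contra hne
        exact hi (Finset.mem_filter.2 ⟨by by_contra hiF; exact hne (hxF i hiF), hne⟩)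
      simpa [hx0] using hz i his
  obtain ⟨hkF, hk0⟩ := Finset.mem_filter.1 hk
  have hkend : z k + t k * x k = 0 ∨ z k + t k * x k = 1 := by
    simp only [t]
    split_ifs with hpos
    · right; field_simp; ring
    · left; field_simp; ring
  have hlt : (s.filter fun i => z i + t k * x i ≠ 0 ∧ z i + t k * x i ≠ 1).card < N := by
    rw [← hN]
    refine Finset.card_lt_card ⟨?_, ?_⟩
    · intro i hi
      obtain ⟨his, hi⟩ := Finset.mem_filter.1 hi
      by_contra hiF
      have := hxF i hiF
      rw [this, mul_zero, add_zero] at hi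
      exact hiF (Finset.mem_filter.2 ⟨his, hi⟩)
    · intro hsub
      obtain ⟨-, h0, h1⟩ := Finset.mem_filter.1 (hsub hkF)
      exact hkend.elim h0 h1
  obtain ⟨y, hy, hya, hyb, hyc⟩ := ih _ hlt (fun i => z i + t k * x i) hbd rfl
  refine ⟨y, hy, hya.trans ?_, hyb.trans ?_, hyc⟩
  · have : ∑ i ∈ s, a i * (z i + t k * x i) = ∑ i ∈ s, a i * z i + t k * ∑ i ∈ s, a i * x i := by
      rw [Finset.mul_sum, ← Finset.sum_add_distrib]
      exact Finset.sum_congr rfl fun i _ => by ring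
    rw [this, hva, mul_zero, add_zero]
  · have : ∑ i ∈ s, b i * (z i + t k * x i) = ∑ i ∈ s, b i * z i + t k * ∑ i ∈ s, b i * x i := by
      rw [Finset.mul_sum, ← Finset.sum_add_distrib]
      exact Finset.sum_congr rfl fun i _ => by ring
    rw [this, hvb, mul_zero, add_zero]

/-- Coin biases `z` for the states of a distribution `w` on `s`, where adding gains `a` and removing
gains `b`: the expected gain is at least twice the expected loss of any fixed decision, and at most
two of the coins are random. -/
def IsGoodCoin {ι : Type} (s : Finset ι) (w a b z : ι → ℝ) : Prop :=
  (∀ i ∈ s, 0 ≤ z i ∧ z i ≤ 1) ∧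
  2 * ∑ i ∈ s, w i * (z i * b i) ≤ ∑ i ∈ s, w i * (z i * a i + (1 - z i) * b i) ∧
  2 * ∑ i ∈ s, w i * ((1 - z i) * a i) ≤ ∑ i ∈ s, w i * (z i * a i + (1 - z i) * b i) ∧
  (s.filter fun i => z i ≠ 0 ∧ z i ≠ 1).card ≤ 2

/-- If both gains are positive, the bias a/(a+b) reduces both inequalities to 2ab ≤ a² + b²;
otherwise a deterministic choice works. -/
theorem exists_bias {a b : ℝ} (hab : 0 ≤ a + b) :
    ∃ z : ℝ, 0 ≤ z ∧ z ≤ 1 ∧ 2 * (z * b) ≤ z * a + (1 - z) * b ∧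
      2 * ((1 - z) * a) ≤ z * a + (1 - z) * b := by
  by_cases hb : b ≤ 0
  · exact ⟨1, by norm_num, by norm_num, by linarith, by linarith⟩
  by_cases ha : a ≤ 0
  · exact ⟨0, by norm_num, by norm_num, by linarith, by linarith⟩
  push Not at ha hb
  have hs : 0 < a + b := by linarith
  have h1 : 1 - a / (a + b) = b / (a + b) := by field_simp; ring
  refine ⟨a / (a + b), by positivity, by rw [div_le_one hs]; linarith, ?_, ?_⟩ <;>
  · rw [h1]
    have : a / (a + b) * a + b / (a + b) * b = (a * a + b * b) / (a + b) := by ring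
    rw [this, le_div_iff₀ hs]
    field_simp
    nlinarith [sq_nonneg (a - b)]

/-- Pointwise biases satisfy both averaged inequalities, and these involve the biases only through
the two linear forms with coefficients w·a and w·b. So the biases can be rounded while keeping both
forms fixed. -/
theorem exists_isGoodCoin {ι : Type} (s : Finset ι) (w a b : ι → ℝ) (hw : ∀ i ∈ s, 0 ≤ w i)
    (hab : ∀ i ∈ s, 0 ≤ a i + b i) : ∃ z, IsGoodCoin s w a b z := by
  classical
  have h : ∀ i, ∃ z : ℝ, i ∈ s → 0 ≤ z ∧ z ≤ 1 ∧ 2 * (z * b i) ≤ z * a i + (1 - z) * b i ∧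
      2 * ((1 - z) * a i) ≤ z * a i + (1 - z) * b i := by
    intro i
    by_cases hi : i ∈ s
    · obtain ⟨z, hz⟩ := exists_bias (hab i hi)
      exact ⟨z, fun _ => hz⟩
    · exact ⟨0, fun h => absurd h hi⟩
  choose z hz using h
  obtain ⟨y, hy, hya, hyb, hyc⟩ := exists_card_fractional_le_two s
    (fun i => w i * a i) (fun i => w i * b i) z fun i hi => ⟨(hz i hi).1, (hz i hi).2.1⟩
  have e1 : ∀ x : ι → ℝ, ∑ i ∈ s, w i * (x i * a i + (1 - x i) * b i) =
      ∑ i ∈ s, w i * a i * x i + ∑ i ∈ s, w i * b i - ∑ i ∈ s, w i * b i * x i := by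
    intro x
    rw [← Finset.sum_add_distrib, ← Finset.sum_sub_distrib]
    exact Finset.sum_congr rfl fun i _ => by ring
  have e2 : ∀ x : ι → ℝ, ∑ i ∈ s, w i * (x i * b i) = ∑ i ∈ s, w i * b i * x i := fun x =>
    Finset.sum_congr rfl fun i _ => by ring
  have e3 : ∀ x : ι → ℝ, ∑ i ∈ s, w i * ((1 - x i) * a i) =
      ∑ i ∈ s, w i * a i - ∑ i ∈ s, w i * a i * x i := by
    intro x
    rw [← Finset.sum_sub_distrib]
    exact Finset.sum_congr rfl fun i _ => by ring
  refine ⟨y, hy, ?_, ?_, hyc⟩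
  · rw [e1, e2, hya, hyb, ← e1, ← e2, Finset.mul_sum]
    refine Finset.sum_le_sum fun i hi => ?_
    have := mul_le_mul_of_nonneg_left (hz i hi).2.2.1 (hw i hi)
    linarith
  · rw [e1, e3, hya, hyb, ← e1, ← e3, Finset.mul_sum]
    refine Finset.sum_le_sum fun i hi => ?_
    have := mul_le_mul_of_nonneg_left (hz i hi).2.2.2 (hw i hi)
    linarith

/-- A choice of good coin biases, whenever there are some. -/
noncomputable def goodCoin {ι : Type} (s : Finset ι) (w a b : ι → ℝ) : ι → ℝ :=
  open Classical in if h : ∃ z, IsGoodCoin s w a b z then h.choose else 0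

theorem isGoodCoin_goodCoin {ι : Type} {s : Finset ι} {w a b : ι → ℝ} (hw : ∀ i ∈ s, 0 ≤ w i)
    (hab : ∀ i ∈ s, 0 ≤ a i + b i) : IsGoodCoin s w a b (goodCoin s w a b) := by
  have h := exists_isGoodCoin s w a b hw hab
  rw [goodCoin, dif_pos h]
  exact h.choose_spec

/-! ### Derandomized double greedy. -/

section DoubleGreedy

variable {E : Type} [DecidableEq E]

/-- The support after the element `u` is added to `X` with probability `z X`. -/
noncomputable def splitSupport (D : Finset (Finset E)) (z : Finset E → ℝ) (u : E) :
    Finset (Finset E) :=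
  open Classical in (D.filter fun X => z X ≠ 0).image (insert u) ∪ D.filter fun X => z X ≠ 1

/-- The distribution after the element `u` is added to `X` with probability `z X`. -/
noncomputable def splitWeight (w z : Finset E → ℝ) (u : E) : Finset E → ℝ := fun X =>
  if u ∈ X then w (X.erase u) * z (X.erase u) else w X * (1 - z X)

/-- As `u` lies in no set of `D`, the sets with and without `u` never collide, so an expectation
after the split is one over the old set and its coin. -/
theorem sum_split {D : Finset (Finset E)} {u : E} (hu : ∀ X ∈ D, u ∉ X) (w z g : Finset E → ℝ) :
    ∑ X ∈ splitSupport D z u, splitWeight w z u X * g X =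
      ∑ X ∈ D, w X * (z X * g (insert u X) + (1 - z X) * g X) := by
  classical
  rw [splitSupport, Finset.sum_union, Finset.sum_image]
  · have e1 : ∑ X ∈ D.filter (fun X => z X ≠ 0), splitWeight w z u (insert u X) * g (insert u X) =
        ∑ X ∈ D, w X * (z X * g (insert u X)) := by
      rw [Finset.sum_filter]
      refine Finset.sum_congr rfl fun X hX => ?_
      by_cases h : z X = 0
      · simp [h]
      · simp [h, splitWeight, Finset.erase_insert (hu X hX), mul_assoc]
    have e2 : ∑ X ∈ D.filter (fun X => z X ≠ 1), splitWeight w z u X * g X =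
        ∑ X ∈ D, w X * ((1 - z X) * g X) := by
      rw [Finset.sum_filter]
      refine Finset.sum_congr rfl fun X hX => ?_
      by_cases h : z X = 1
      · simp [h]
      · simp [h, splitWeight, hu X hX, mul_assoc]
    rw [e1, e2, ← Finset.sum_add_distrib]
    exact Finset.sum_congr rfl fun X _ => by ring
  · intro X hX Y hY hXY
    have hX' := hu X (Finset.mem_filter.1 hX).1
    have hY' := hu Y (Finset.mem_filter.1 hY).1
    simpa [Finset.erase_insert hX', Finset.erase_insert hY'] using congrArg (·.erase u) hXY
  · rw [Finset.disjoint_left]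
    intro X hX hX'
    obtain ⟨Y, -, rfl⟩ := Finset.mem_image.1 hX
    exact hu _ (Finset.mem_filter.1 hX').1 (Finset.mem_insert_self _ _)

/-- Only a set with a fractional coin has two descendants. -/
theorem card_splitSupport_le (D : Finset (Finset E)) {z : Finset E → ℝ} (u : E)
    (hz : (D.filter fun X => z X ≠ 0 ∧ z X ≠ 1).card ≤ 2) :
    (splitSupport D z u).card ≤ D.card + 2 := by
  classical
  have h1 := Finset.card_union_le ((D.filter fun X => z X ≠ 0).image (insert u))
    (D.filter fun X => z X ≠ 1)
  have h2 : ((D.filter fun X => z X ≠ 0).image (insert u)).card ≤ _ := Finset.card_image_le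
  have h3 := Finset.card_union_add_card_inter (D.filter fun X => z X ≠ 0) (D.filter fun X => z X ≠ 1)
  rw [← Finset.filter_and, ← Finset.filter_or] at h3
  have h4 : (D.filter fun X => z X ≠ 0 ∨ z X ≠ 1).card ≤ D.card := Finset.card_filter_le _ _
  have h5 : (D.filter fun X => z X ≠ 0 ∧ z X ≠ 1).card ≤ 2 := by convert hz
  unfold splitSupport
  omega

theorem mem_splitSupport {D : Finset (Finset E)} {z : Finset E → ℝ} {u : E} {X : Finset E}
    (hX : X ∈ splitSupport D z u) : X ∈ D ∨ ∃ Y ∈ D, X = insert u Y := by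
  classical
  rcases Finset.mem_union.1 hX with h | h
  · obtain ⟨Y, hY, rfl⟩ := Finset.mem_image.1 h
    exact Or.inr ⟨Y, (Finset.mem_filter.1 hY).1, rfl⟩
  · exact Or.inl (Finset.mem_filter.1 h).1

theorem splitWeight_nonneg {D : Finset (Finset E)} {w z : Finset E → ℝ} {u : E}
    (hu : ∀ X ∈ D, u ∉ X) (hw : ∀ X ∈ D, 0 ≤ w X) (hz : ∀ X ∈ D, 0 ≤ z X ∧ z X ≤ 1)
    {X : Finset E} (hX : X ∈ splitSupport D z u) : 0 ≤ splitWeight w z u X := by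
  unfold splitWeight
  rcases mem_splitSupport hX with h | ⟨Y, h, rfl⟩
  · rw [if_neg (hu X h)]
    exact mul_nonneg (hw X h) (by linarith [(hz X h).2])
  · rw [if_pos (Finset.mem_insert_self _ _), Finset.erase_insert (hu Y h)]
    exact mul_nonneg (hw Y h) (hz Y h).1

namespace QueryProg

/-- The main loop of the derandomized double greedy algorithm of Buchbinder and Feldman: `D` and `w`
are a distribution of the lower sets `X`, and `X ∪ R` is the upper set, where `R` consists of the
elements that are still to be treated. -/
noncomputable def doubleGreedyLoop :
    List E → Finset (Finset E) → (Finset E → ℝ) → QueryProg E (Finset E)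
  | [], D, _ => best D
  | u :: L, D, w =>
    (askValues (((D ∪ D.image fun X => insert u X) ∪ D.image fun X => X ∪ L.toFinset) ∪
      D.image fun X => X ∪ insert u L.toFinset)).bind fun g =>
    let z := goodCoin D w (fun X => g (insert u X) - g X)
      (fun X => g (X ∪ L.toFinset) - g (X ∪ insert u L.toFinset))
    doubleGreedyLoop L (splitSupport D z u) (splitWeight w z u)

/-- Deterministic unconstrained maximization over the subsets of `S`. -/
noncomputable def doubleGreedy (S : Finset E) : QueryProg E (Finset E) :=
  doubleGreedyLoop S.toList {∅} fun _ => 1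

variable {f : Finset E → ℝ} {Indep : Finset E → Prop}

/-- The left side is a potential: lower set plus upper set plus twice a reference set agreeing with
`T` on the untreated elements. A good coin gains at least twice what the reference set loses, so the
potential never decreases. The support grows by at most two per element, which makes the query count
quadratic. -/
theorem yields_doubleGreedyLoop (hf : IsSubmodular f) (L : List E) (hL : L.Nodup) :
    ∀ (D : Finset (Finset E)) (w : Finset E → ℝ) (A : Finset E), (∀ X ∈ D, 0 ≤ w X) →
      ∑ X ∈ D, w X = 1 → (∀ X ∈ D, X ⊆ A ∧ ∀ u ∈ L, u ∉ X) → (∀ u ∈ L, u ∈ A) →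
      (doubleGreedyLoop L D w).Yields f Indep
        (4 * L.length * (D.card + L.length) + D.card + 2 * L.length) fun U =>
        U ⊆ A ∧ ∀ T : Finset E, ∑ X ∈ D, w X * (f X + f (X ∪ L.toFinset)) +
          2 * ∑ X ∈ D, w X * f (X ∪ (T ∩ L.toFinset)) ≤ 4 * f U := by
  induction L with
  | nil =>
    intro D w A hw hw1 hD _
    have hne : D.Nonempty := by
      rw [Finset.nonempty_iff_ne_empty]
      rintro rfl
      simp at hw1
    refine (yields_best hne).mono (by simp) fun U hU => ⟨(hD U hU.1).1, fun T => ?_⟩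
    -- The best set of the support is at least as good as the average.
    have : ∑ X ∈ D, w X * f X ≤ f U := by
      calc ∑ X ∈ D, w X * f X ≤ ∑ X ∈ D, w X * f U :=
            Finset.sum_le_sum fun X hX => mul_le_mul_of_nonneg_left (hU.2 X hX) (hw X hX)
        _ = f U := by rw [← Finset.sum_mul, hw1, one_mul]
    have e : ∑ X ∈ D, w X * (f X + f X) = 2 * ∑ X ∈ D, w X * f X := by
      rw [Finset.mul_sum]
      exact Finset.sum_congr rfl fun X _ => by ring
    simp only [List.toFinset_nil, Finset.union_empty, Finset.inter_empty, e]
    linarith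
  | cons u L ih =>
    intro D w A hw hw1 hD hLA
    obtain ⟨huL, hL⟩ := List.nodup_cons.1 hL
    set R := L.toFinset with hR
    have huR : u ∉ R := by simpa [hR] using huL
    have hu : ∀ X ∈ D, u ∉ X := fun X hX => (hD X hX).2 u (by simp)
    have hcard : (((D ∪ D.image fun X => insert u X) ∪ D.image fun X => X ∪ R) ∪
        D.image fun X => X ∪ insert u R).card ≤ 4 * D.card := by
      have h1 := Finset.card_union_le ((D ∪ D.image fun X => insert u X) ∪ D.image fun X => X ∪ R)
        (D.image fun X => X ∪ insert u R)
      have h2 := Finset.card_union_le (D ∪ D.image fun X => insert u X) (D.image fun X => X ∪ R)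
      have h3 := Finset.card_union_le D (D.image fun X => insert u X)
      have h4 : (D.image fun X => insert u X).card ≤ _ := Finset.card_image_le
      have h5 : (D.image fun X => X ∪ R).card ≤ _ := Finset.card_image_le
      have h6 : (D.image fun X => X ∪ insert u R).card ≤ _ := Finset.card_image_le
      omega
    refine ((yields_askValues _).bind (k' := 4 * L.length * (D.card + 2 + L.length) + (D.card + 2) +
      2 * L.length) fun g hg => ?_).mono (by simp only [List.length_cons]; nlinarith) fun _ => id
    have hg1 : ∀ X ∈ D, g X = f X := fun X hX => hg X (by simp [hX])
    have hg2 : ∀ X ∈ D, g (insert u X) = f (insert u X) := fun X hX => hg _ (by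
      simp only [Finset.mem_union, Finset.mem_image]; exact Or.inl (Or.inl (Or.inr ⟨X, hX, rfl⟩)))
    have hg3 : ∀ X ∈ D, g (X ∪ R) = f (X ∪ R) := fun X hX => hg _ (by
      simp only [Finset.mem_union, Finset.mem_image]; exact Or.inl (Or.inr ⟨X, hX, rfl⟩))
    have hg4 : ∀ X ∈ D, g (X ∪ insert u R) = f (X ∪ insert u R) := fun X hX => hg _ (by
      simp only [Finset.mem_union, Finset.mem_image]; exact Or.inr ⟨X, hX, rfl⟩)
    set a : Finset E → ℝ := fun X => g (insert u X) - g X with ha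
    set b : Finset E → ℝ := fun X => g (X ∪ R) - g (X ∪ insert u R) with hb
    have hab : ∀ X ∈ D, 0 ≤ a X + b X := by
      intro X hX
      have h := hf (insert u X) (X ∪ R)
      have e1 : insert u X ∪ (X ∪ R) = X ∪ insert u R := by ext y; simp
      have e2 : insert u X ∩ (X ∪ R) = X := by
        ext y
        simp only [Finset.mem_inter, Finset.mem_insert, Finset.mem_union]
        constructor
        · rintro ⟨rfl | h, h' | h'⟩
          · exact h'
          · exact absurd h' huR
          · exact h'
          · exact h
        · tauto
      rw [e1, e2] at h
      simp only [ha, hb, hg1 X hX, hg2 X hX, hg3 X hX, hg4 X hX]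
      linarith
    have hcoin := isGoodCoin_goodCoin hw hab
    show (doubleGreedyLoop L (splitSupport D (goodCoin D w a b) u)
      (splitWeight w (goodCoin D w a b) u)).Yields f Indep _ _
    set z := goodCoin D w a b
    obtain ⟨hz, hz1, hz2, hz3⟩ := hcoin
    have hc := card_splitSupport_le D u (z := z) (by convert hz3)
    have hDs : ∀ X ∈ splitSupport D z u, X ⊆ A ∧ ∀ v ∈ L, v ∉ X := by
      intro X hX
      rcases mem_splitSupport hX with h | ⟨Y, h, rfl⟩
      · exact ⟨(hD X h).1, fun v hv => (hD X h).2 v (List.mem_cons_of_mem _ hv)⟩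
      · refine ⟨Finset.insert_subset (hLA u (by simp)) (hD Y h).1, fun v hv => ?_⟩
        rw [Finset.mem_insert, not_or]
        exact ⟨fun hvu => huL (hvu ▸ hv), (hD Y h).2 v (List.mem_cons_of_mem _ hv)⟩
    have hsum1 : ∑ X ∈ splitSupport D z u, splitWeight w z u X = 1 := by
      have := sum_split hu w z fun _ => 1
      simp only [mul_one] at this
      rw [this]
      exact (Finset.sum_congr rfl fun X _ => by ring).trans hw1
    refine (ih hL _ _ A (fun X hX => splitWeight_nonneg hu hw hz hX) hsum1 hDs
      fun v hv => hLA v (List.mem_cons_of_mem _ hv)).mono ?_ ?_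
    · gcongr
    rintro U ⟨hUA, hU⟩
    refine ⟨hUA, fun T => ?_⟩
    have h := hU T
    rw [sum_split hu w z (fun X => f X + f (X ∪ R)), sum_split hu w z (fun X => f (X ∪ (T ∩ R)))] at h
    refine le_trans ?_ h
    have eR : (u :: L).toFinset = insert u R := by simp [hR]
    rw [eR]
    have gain : ∑ X ∈ D, w X * (z X * (f (insert u X) + f (insert u X ∪ R)) +
          (1 - z X) * (f X + f (X ∪ R))) =
        ∑ X ∈ D, w X * (f X + f (X ∪ insert u R)) +
          ∑ X ∈ D, w X * (z X * a X + (1 - z X) * b X) := by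
      rw [← Finset.sum_add_distrib]
      refine Finset.sum_congr rfl fun X hX => ?_
      have e : insert u X ∪ R = X ∪ insert u R := by ext y; simp
      simp only [ha, hb, hg1 X hX, hg2 X hX, hg3 X hX, hg4 X hX, e]
      ring
    rw [gain]
    -- The reference set changes only when the coin disagrees with `T` about `u`; submodularity
    -- bounds the drop by the gain of the option not taken.
    by_cases huT : u ∈ T
    · have loss : ∑ X ∈ D, w X * f (X ∪ (T ∩ insert u R)) ≤
          ∑ X ∈ D, w X * (z X * f (insert u X ∪ (T ∩ R)) + (1 - z X) * f (X ∪ (T ∩ R))) +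
            ∑ X ∈ D, w X * ((1 - z X) * a X) := by
        rw [← Finset.sum_add_distrib]
        refine Finset.sum_le_sum fun X hX => ?_
        have e : X ∪ (T ∩ insert u R) = insert u X ∪ (T ∩ R) := by
          ext y
          simp only [Finset.mem_union, Finset.mem_inter, Finset.mem_insert]
          by_cases hy : y = u
          · subst hy; simp [huT]
          · simp [hy]
        have hs := hf (insert u X) (X ∪ (T ∩ R))
        have e1 : insert u X ∪ (X ∪ (T ∩ R)) = insert u X ∪ (T ∩ R) := by ext y; simp
        have e2 : insert u X ∩ (X ∪ (T ∩ R)) = X := by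
          ext y
          simp only [Finset.mem_inter, Finset.mem_insert, Finset.mem_union]
          constructor
          · rintro ⟨rfl | h, h' | h'⟩
            · exact h'
            · exact absurd h'.2 huR
            · exact h'
            · exact h
          · tauto
        rw [e1, e2] at hs
        rw [e, ← mul_add]
        refine mul_le_mul_of_nonneg_left ?_ (hw X hX)
        simp only [ha, hg1 X hX, hg2 X hX]
        nlinarith [(hz X hX).2]
      linarith
    · have loss : ∑ X ∈ D, w X * f (X ∪ (T ∩ insert u R)) ≤
          ∑ X ∈ D, w X * (z X * f (insert u X ∪ (T ∩ R)) + (1 - z X) * f (X ∪ (T ∩ R))) +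
            ∑ X ∈ D, w X * (z X * b X) := by
        rw [← Finset.sum_add_distrib]
        refine Finset.sum_le_sum fun X hX => ?_
        have e : X ∪ (T ∩ insert u R) = X ∪ (T ∩ R) := by
          ext y
          simp only [Finset.mem_union, Finset.mem_inter, Finset.mem_insert]
          by_cases hy : y = u
          · subst hy; simp [huT, huR]
          · simp [hy]
        have hs := hf (insert u X ∪ (T ∩ R)) (X ∪ R)
        have e1 : (insert u X ∪ (T ∩ R)) ∪ (X ∪ R) = X ∪ insert u R := by
          ext y; simp; tauto
        have e2 : (insert u X ∪ (T ∩ R)) ∩ (X ∪ R) = X ∪ (T ∩ R) := by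
          ext y
          simp only [Finset.mem_inter, Finset.mem_insert, Finset.mem_union]
          by_cases hy : y = u
          · subst hy; simp [huT, huR]
          · simp [hy]; tauto
        rw [e1, e2] at hs
        rw [e, ← mul_add]
        refine mul_le_mul_of_nonneg_left ?_ (hw X hX)
        simp only [hb, hg3 X hX, hg4 X hX]
        nlinarith [(hz X hX).1]
      linarith

theorem yields_doubleGreedy (hf : IsSubmodular f) (h0 : ∀ S, 0 ≤ f S) (S : Finset E) :
    (doubleGreedy S).Yields f Indep (4 * S.card * S.card + 6 * S.card + 1) fun U =>
      U ⊆ S ∧ ∀ T ⊆ S, f T ≤ 2 * f U := by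
  refine (yields_doubleGreedyLoop hf S.toList S.nodup_toList {∅} (fun _ => 1) S (by simp) (by simp)
    (by simp) (by simp)).mono ?_ ?_
  · simp only [Finset.length_toList, Finset.card_singleton]
    nlinarith
  · rintro U ⟨hU, h⟩
    refine ⟨hU, fun T hT => ?_⟩
    have := h T
    simp only [Finset.sum_singleton, Finset.toList_toFinset, Finset.empty_union, one_mul,
      Finset.inter_eq_left.2 hT] at this
    linarith [h0 ∅, h0 S]

end QueryProg

end DoubleGreedy

/-! ### Submodular functions and p-systems. -/

section Submodular

variable {E : Type} [DecidableEq E] {f : Finset E → ℝ}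

theorem IsSubmodular.marginal_anti (hf : IsSubmodular f) {S S' : Finset E} (h : S ⊆ S') {e : E}
    (he : e ∉ S') : f (insert e S') - f S' ≤ f (insert e S) - f S := by
  have h1 := hf (insert e S) S'
  have e1 : insert e S ∪ S' = insert e S' := by
    rw [Finset.insert_union, Finset.union_eq_right.2 h]
  have e2 : insert e S ∩ S' = S := by
    rw [Finset.insert_inter_of_notMem he, Finset.inter_eq_left.2 h]
  rw [e1, e2] at h1
  linarith

theorem IsSubmodular.union_le_add_sum (hf : IsSubmodular f) (S T : Finset E) :
    f (S ∪ T) ≤ f S + ∑ e ∈ T \ S, (f (insert e S) - f S) := by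
  have key : ∀ R : Finset E, Disjoint R S →
      f (S ∪ R) ≤ f S + ∑ e ∈ R, (f (insert e S) - f S) := by
    intro R
    induction R using Finset.induction_on with
    | empty => simp
    | insert a R ha ih =>
      intro hd
      obtain ⟨haS, hd⟩ := Finset.disjoint_insert_left.1 hd
      rw [Finset.sum_insert ha, Finset.union_insert]
      have := hf.marginal_anti (Finset.subset_union_left : S ⊆ S ∪ R) (e := a) (by simp [ha, haS])
      linarith [ih hd]
  simpa using key (T \ S) Finset.sdiff_disjoint

theorem IsSubmodular.union_le (hf : IsSubmodular f) (h0 : ∀ S, 0 ≤ f S) (S T : Finset E) :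
    f (S ∪ T) ≤ f S + f T := by
  linarith [hf S T, h0 (S ∩ T)]

end Submodular

section PSystem

variable {E : Type} {p : ℕ} {Indep : Finset E → Prop}

/-- Here `S` is a base of `S ∪ R`, while `R` extends to another base of it. -/
theorem IsPSystem.card_le_of_rejected [Finite E] [DecidableEq E] (hI : IsPSystem p Indep)
    {S R : Finset E} (hS : Indep S) (hR : Indep R) (h : ∀ e ∈ R, e ∉ S → ¬Indep (insert e S)) :
    R.card ≤ p * S.card := by
  have hSb : IsBaseOf Indep (S ∪ R) S := by
    refine ⟨⟨Finset.subset_union_left, hS⟩, fun B ⟨hB, hBI⟩ hSB e he => ?_⟩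
    by_contra heS
    have heR : e ∈ R := (Finset.mem_union.1 (hB he)).resolve_left heS
    exact h e heR heS (hI.subset _ _ hBI (Finset.insert_subset he hSB))
  obtain ⟨B, hRB, hB⟩ := (Set.toFinite {B : Finset E | B ⊆ S ∪ R ∧ Indep B}).exists_le_maximal
    (show R ∈ {B : Finset E | B ⊆ S ∪ R ∧ Indep B} from ⟨Finset.subset_union_right, hR⟩)
  exact (Finset.card_le_card hRB).trans (hI.card_le _ _ _ hB hSb)

end PSystem

/-! ### Greedy with a density threshold. -/

section Greedy

variable {E : Type} {d : ℕ}

/-- The total cost of an element over all knapsacks. -/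
def totalCost (c : Fin d → E → ℝ) (e : E) : ℝ := ∑ i, c i e

theorem IsFeasible.subset {p : ℕ} {Indep : Finset E → Prop} (hI : IsPSystem p Indep)
    {c : Fin d → E → ℝ} (hc : ∀ i e, 0 ≤ c i e) {S T : Finset E} (hT : IsFeasible Indep c T)
    (h : S ⊆ T) : IsFeasible Indep c S :=
  ⟨hI.subset _ _ hT.1 h, fun i =>
    (Finset.sum_le_sum_of_subset_of_nonneg h fun e _ _ => hc i e).trans (hT.2 i)⟩

theorem IsFeasible.sum_totalCost_le {Indep : Finset E → Prop} {c : Fin d → E → ℝ} {T : Finset E}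
    (hT : IsFeasible Indep c T) : ∑ e ∈ T, totalCost c e ≤ d := by
  unfold totalCost
  rw [Finset.sum_comm]
  calc ∑ i, ∑ e ∈ T, c i e ≤ ∑ _i : Fin d, (1 : ℝ) := Finset.sum_le_sum fun i _ => hT.2 i
    _ = d := by simp

variable [DecidableEq E]

/-- The element `x` can be added to `S`: the result is independent and the density of `x` is at
least `ρ`. -/
def IsCandidate (f : Finset E → ℝ) (Indep : Finset E → Prop) (c : Fin d → E → ℝ) (ρ : ℝ)
    (A S : Finset E) (x : E) : Prop :=
  x ∈ A \ S ∧ Indep (insert x S) ∧ ρ * totalCost c x ≤ f (insert x S) - f S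

/-- The invariant of the greedy algorithm with density threshold `ρ` on the ground set `A`. The
elements that the current set `S` rejects have small total marginal value, and this remains true if
further elements are rejected later, up to the number that a `p`-system allows. -/
structure GreedyInvariant (p : ℕ) (f : Finset E → ℝ) (Indep : Finset E → Prop)
    (c : Fin d → E → ℝ) (ρ : ℝ) (A S : Finset E) : Prop where
  subset : S ⊆ A
  feasible : IsFeasible Indep c S
  density : ρ * ∑ e ∈ S, totalCost c e ≤ f S
  rejected : ∀ (R : Finset E) (δ : ℝ), Indep R →
    (∀ e ∈ R, e ∈ A \ S ∧ ¬Indep (insert e S) ∧ ρ * totalCost c e ≤ f (insert e S) - f S) →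
    0 ≤ δ → (0 < δ → ∃ x, IsCandidate f Indep c ρ A S x ∧ δ ≤ f (insert x S) - f S) →
    ∑ e ∈ R, (f (insert e S) - f S) + ((p : ℝ) * S.card - R.card) * δ ≤ p * f S

variable {p : ℕ} {f : Finset E → ℝ} {Indep : Finset E → Prop} {c : Fin d → E → ℝ} {ρ : ℝ}
  {A S : Finset E}

theorem greedyInvariant_empty (h0 : ∀ S, 0 ≤ f S) (hI : IsPSystem p Indep) :
    GreedyInvariant p f Indep c ρ A ∅ where
  subset := Finset.empty_subset _
  feasible := ⟨hI.empty, fun i => by simp⟩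
  density := by simpa using h0 ∅
  rejected R δ hR h _ _ := by
    have : R = ∅ := by
      rw [Finset.eq_empty_iff_forall_notMem]
      exact fun e he => (h e he).2.1 (hI.subset _ _ hR (by simpa using he))
    subst this
    simpa using mul_nonneg (Nat.cast_nonneg p) (h0 ∅)

theorem GreedyInvariant.density_insert (h : GreedyInvariant p f Indep c ρ A S) {x : E}
    (hx : IsCandidate f Indep c ρ A S x) :
    ρ * ∑ e ∈ insert x S, totalCost c e ≤ f (insert x S) := by
  rw [Finset.sum_insert (Finset.mem_sdiff.1 hx.1).2, mul_add]
  linarith [h.density, hx.2.2]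

/-- In `rejected`, the p-system grants p·|S| rejections, and the unused ones are reserved at price
δ, at most the marginal of an available candidate. Adding `x` with marginal δ' raises the budget
p·f(S) by p·δ'. Newly rejected elements were candidates, so each costs at most δ', and δ ≤ δ' since
marginals shrink. -/
theorem GreedyInvariant.insert_of_isCandidate [Finite E] (hf : IsSubmodular f) (hI : IsPSystem p Indep)
    (hc : ∀ i e, 0 ≤ c i e) (hρ : 0 ≤ ρ) (h : GreedyInvariant p f Indep c ρ A S) {x : E}
    (hx : IsCandidate f Indep c ρ A S x)
    (hmax : ∀ y, IsCandidate f Indep c ρ A S y → f (insert y S) ≤ f (insert x S))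
    (hxc : ∀ i, ∑ e ∈ insert x S, c i e ≤ 1) :
    GreedyInvariant p f Indep c ρ A (insert x S) where
  subset := Finset.insert_subset (Finset.mem_sdiff.1 hx.1).1 h.subset
  feasible := ⟨hx.2.1, hxc⟩
  density := h.density_insert hx
  rejected R δ hR hRrej hδ hδx := by
    classical
    have hsub : S ⊆ insert x S := Finset.subset_insert x S
    have hanti : ∀ e, e ∈ A \ insert x S →
        f (insert e (insert x S)) - f (insert x S) ≤
          f (insert e S) - f S :=
      fun e he => hf.marginal_anti hsub (Finset.mem_sdiff.1 he).2
    have hmem : ∀ e, e ∈ A \ insert x S → e ∈ A \ S := fun e he =>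
      Finset.mem_sdiff.2 ⟨(Finset.mem_sdiff.1 he).1, fun h => (Finset.mem_sdiff.1 he).2 (hsub h)⟩
    set δ' := f (insert x S) - f S with hδ'
    have hδ'0 : 0 ≤ δ' :=
      (mul_nonneg hρ (Finset.sum_nonneg fun i _ => hc i x)).trans hx.2.2
    have hδδ' : δ ≤ δ' := by
      rcases hδ.eq_or_lt with h0 | hpos
      · rw [← h0]; exact hδ'0
      · obtain ⟨y, ⟨hy1, hy2, hy3⟩, hy4⟩ := hδx hpos
        have hy : IsCandidate f Indep c ρ A S y :=
          ⟨hmem y hy1, hI.subset _ _ hy2 (Finset.insert_subset_insert _ hsub),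
            hy3.trans (hanti y hy1)⟩
        linarith [hmax y hy, hanti y hy1]
    have hcardR : (R.card : ℝ) ≤ p * (insert x S).card := by
      exact_mod_cast hI.card_le_of_rejected hx.2.1 hR fun e he _ => (hRrej e he).2.1
    have hcardS : ((insert x S).card : ℝ) = S.card + 1 := by
      rw [Finset.card_insert_of_notMem (Finset.mem_sdiff.1 hx.1).2]; push_cast; ring
    -- `R₁` was already rejected by `S`; `R₂` is rejected only because of `x`.
    set R₁ := R.filter fun e => ¬Indep (insert e S) with hR₁
    set R₂ := R.filter fun e => ¬¬Indep (insert e S) with hR₂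
    have hcard12 : (R.card : ℝ) = R₁.card + R₂.card := by
      rw [hR₁, hR₂]
      exact_mod_cast (Finset.card_filter_add_card_filter_not
        (fun e => ¬Indep (insert e S))).symm
    have h1 := h.rejected R₁ δ' (hI.subset _ _ hR (Finset.filter_subset _ _))
      (fun e he => by
        obtain ⟨heR, hei⟩ := Finset.mem_filter.1 he
        obtain ⟨he1, -, he3⟩ := hRrej e heR
        exact ⟨hmem e he1, hei, he3.trans (hanti e he1)⟩) hδ'0 fun _ => ⟨x, hx, le_rfl⟩
    have h2 : ∑ e ∈ R₂, (f (insert e S) - f S) ≤ R₂.card * δ' := by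
      rw [← nsmul_eq_mul]
      refine Finset.sum_le_card_nsmul _ _ _ fun e he => ?_
      obtain ⟨heR, hei⟩ := Finset.mem_filter.1 he
      obtain ⟨he1, -, he3⟩ := hRrej e heR
      linarith [hmax e ⟨hmem e he1, not_not.1 hei, he3.trans (hanti e he1)⟩]
    have h3 : ∑ e ∈ R, (f (insert e (insert x S)) - f (insert x S)) ≤
        ∑ e ∈ R₁, (f (insert e S) - f S) + ∑ e ∈ R₂, (f (insert e S) - f S) := by
      rw [hR₁, hR₂, Finset.sum_filter_add_sum_filter_not]
      exact Finset.sum_le_sum fun e he => hanti e (hRrej e he).1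
    have h4 : ((p : ℝ) * (insert x S).card - R.card) * δ ≤
        ((p : ℝ) * (insert x S).card - R.card) * δ' :=
      mul_le_mul_of_nonneg_left hδδ' (by linarith)
    have h5 : f (insert x S) = f S + δ' := by rw [hδ']; ring
    rw [h5]
    rw [hcardS, hcard12] at h4 ⊢
    nlinarith [h5 ▸ h3]

/-- Elements of `T` dense enough for ρ are all rejected by independence and fall under the invariant
with δ = 0; the others are paid for by their cost. -/
theorem GreedyInvariant.union_le (hf : IsSubmodular f) (hI : IsPSystem p Indep)
    (hc : ∀ i e, 0 ≤ c i e) (hρ : 0 ≤ ρ) (h : GreedyInvariant p f Indep c ρ A S)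
    (hno : ∀ x, ¬IsCandidate f Indep c ρ A S x) {T : Finset E} (hTA : T ⊆ A)
    (hT : IsFeasible Indep c T) : f (S ∪ T) ≤ ((p : ℝ) + 1) * f S + d * ρ := by
  classical
  set P : E → Prop := fun e => ρ * totalCost c e ≤ f (insert e S) - f S
  have hmem : ∀ e ∈ T \ S, e ∈ A \ S := fun e he => Finset.sdiff_subset_sdiff hTA le_rfl he
  have h1 := h.rejected ((T \ S).filter P) 0
    (hI.subset _ _ hT.1 ((Finset.filter_subset _ _).trans Finset.sdiff_subset))
    (fun e he => by
      obtain ⟨he1, he2⟩ := Finset.mem_filter.1 he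
      exact ⟨hmem e he1, fun hi => hno e ⟨hmem e he1, hi, he2⟩, he2⟩) le_rfl
    fun h => absurd h (lt_irrefl _)
  have h2 : ∑ e ∈ (T \ S).filter (fun e => ¬P e), (f (insert e S) - f S) ≤ d * ρ := by
    calc ∑ e ∈ (T \ S).filter (fun e => ¬P e), (f (insert e S) - f S)
        ≤ ∑ e ∈ (T \ S).filter (fun e => ¬P e), ρ * totalCost c e :=
          Finset.sum_le_sum fun e he => (not_le.1 (Finset.mem_filter.1 he).2).le
      _ ≤ ∑ e ∈ T, ρ * totalCost c e :=
          Finset.sum_le_sum_of_subset_of_nonneg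
            ((Finset.filter_subset _ _).trans Finset.sdiff_subset)
            fun e _ _ => mul_nonneg hρ (Finset.sum_nonneg fun i _ => hc i e)
      _ = ρ * ∑ e ∈ T, totalCost c e := (Finset.mul_sum _ _ _).symm
      _ ≤ ρ * d := mul_le_mul_of_nonneg_left hT.sum_totalCost_le hρ
      _ = d * ρ := mul_comm _ _
  have h3 := hf.union_le_add_sum S T
  rw [← Finset.sum_filter_add_sum_filter_not (T \ S) P] at h3
  linarith

namespace QueryProg

open Classical in
/-- The greedy algorithm with density threshold `ρ` on the ground set `A`, started from `S`. It stops
when there is no candidate left, or when the best candidate does not fit into the knapsacks; the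
second component of the output tells whether the latter has happened. -/
noncomputable def densityGreedy (c : Fin d → E → ℝ) (ρ : ℝ) (A : Finset E) :
    ℕ → Finset E → QueryProg E (Finset E × Bool)
  | 0, S => ret (S, false)
  | k + 1, S =>
    (askValues (insert S ((A \ S).image fun x => insert x S))).bind fun g =>
    (askIndep ((A \ S).image fun x => insert x S)).bind fun J =>
    match ((A \ S).filter fun x => J (insert x S) = true ∧
        ρ * totalCost c x ≤ g (insert x S) - g S).argmax? fun x => g (insert x S) with
    | none => ret (S, false)
    | some x =>
      if ∀ i, ∑ e ∈ insert x S, c i e ≤ 1 then densityGreedy c ρ A k (insert x S)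
      else ret (S, true)

/-- What the density greedy algorithm guarantees for its output. -/
def GreedyOutput (p : ℕ) (f : Finset E → ℝ) (Indep : Finset E → Prop) (c : Fin d → E → ℝ) (ρ : ℝ)
    (A : Finset E) (o : Finset E × Bool) : Prop :=
  o.1 ⊆ A ∧ IsFeasible Indep c o.1 ∧
    (o.2 = true → ∃ x ∈ A, Indep {x} ∧ ρ ≤ f o.1 + f {x}) ∧
    (o.2 = false → ∀ T ⊆ A, IsFeasible Indep c T → f (o.1 ∪ T) ≤ ((p : ℝ) + 1) * f o.1 + d * ρ)

theorem yields_densityGreedy [Finite E] (hf : IsSubmodular f) (h0 : ∀ S, 0 ≤ f S)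
    (hI : IsPSystem p Indep) (hc : ∀ i e, 0 ≤ c i e) (hρ : 0 ≤ ρ) {r : ℕ}
    (hr : ∀ T, IsFeasible Indep c T → T.card ≤ r) (k : ℕ) :
    ∀ S : Finset E, GreedyInvariant p f Indep c ρ A S → (A \ S).card ≤ k →
      (densityGreedy c ρ A k S).Yields f Indep ((2 * A.card + 1) * (r + 1 - S.card))
        (GreedyOutput p f Indep c ρ A) := by
  classical
  induction k with
  | zero =>
    intro S hS hk
    refine ⟨hS.subset, hS.feasible, fun h => (Bool.false_ne_true h).elim, fun _ T hTA hT => ?_⟩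
    refine hS.union_le hf hI hc hρ (fun x hx => ?_) hTA hT
    exact Finset.notMem_empty _ (Finset.card_eq_zero.1 (Nat.le_zero.1 hk) ▸ hx.1)
  | succ k ih =>
    intro S hS hk
    have hSr := hr S hS.feasible
    have hAS : (A \ S).card ≤ A.card := Finset.card_le_card Finset.sdiff_subset
    have hc2 : ((A \ S).image fun x => insert x S).card ≤ A.card := Finset.card_image_le.trans hAS
    have hc1 : (insert S ((A \ S).image fun x => insert x S)).card ≤ A.card + 1 :=
      (Finset.card_insert_le _ _).trans (Nat.succ_le_succ hc2)
    -- The factor is r + 1 - |S| because the round that finally stops also makes queries.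
    have hcost : A.card + 1 + (A.card + (2 * A.card + 1) * (r - S.card)) =
        (2 * A.card + 1) * (r + 1 - S.card) := by
      rw [Nat.succ_sub hSr, Nat.succ_eq_add_one]; ring
    rw [← hcost]
    refine ((yields_askValues _).mono hc1 fun _ => id).bind fun g hg => ?_
    refine ((yields_askIndep _).mono hc2 fun _ => id).bind fun J hJ => ?_
    have hgS : g S = f S := hg S (Finset.mem_insert_self _ _)
    have hgx : ∀ x ∈ A \ S, g (insert x S) = f (insert x S) := fun x hx =>
      hg _ (Finset.mem_insert_of_mem (Finset.mem_image_of_mem _ hx))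
    have hJx : ∀ x ∈ A \ S, (J (insert x S) = true ↔ Indep (insert x S)) := fun x hx =>
      hJ _ (Finset.mem_image_of_mem _ hx)
    have hcand : ∀ x, x ∈ (A \ S).filter (fun x => J (insert x S) = true ∧
        ρ * totalCost c x ≤ g (insert x S) - g S) ↔ IsCandidate f Indep c ρ A S x := by
      intro x
      rw [Finset.mem_filter]
      constructor
      · rintro ⟨h1, h2, h3⟩
        exact ⟨h1, (hJx x h1).1 h2, by rwa [hgx x h1, hgS] at h3⟩
      · rintro ⟨h1, h2, h3⟩
        exact ⟨h1, (hJx x h1).2 h2, by rwa [hgx x h1, hgS]⟩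
    split
    · rename_i heq
      have hno := Finset.argmax?_eq_none heq
      refine ⟨hS.subset, hS.feasible, fun h => (Bool.false_ne_true h).elim, fun _ T hTA hT => ?_⟩
      refine hS.union_le hf hI hc hρ (fun x hx => ?_) hTA hT
      rw [← hcand, hno] at hx
      exact Finset.notMem_empty _ hx
    · rename_i x heq
      obtain ⟨hx, hmax⟩ := Finset.argmax?_eq_some heq
      rw [hcand] at hx
      obtain ⟨hxA, hxS⟩ := Finset.mem_sdiff.1 hx.1
      split_ifs with hfit
      · refine (ih (insert x S) (hS.insert_of_isCandidate hf hI hc hρ hx (fun y hy => ?_) hfit) ?_).mono ?_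
          fun _ => id
        · have := hmax y ((hcand y).2 hy)
          rwa [hgx x hx.1, hgx y hy.1] at this
        · have : A \ insert x S = (A \ S).erase x := by
            ext y; simp only [Finset.mem_sdiff, Finset.mem_insert, Finset.mem_erase]; tauto
          rw [this, Finset.card_erase_of_mem hx.1]
          omega
        · rw [Finset.card_insert_of_notMem hxS]
          exact Nat.mul_le_mul_left _ (by omega)
      · refine ⟨hS.subset, hS.feasible, fun _ => ⟨x, hxA, hI.subset _ _ hx.2.1 (by simp), ?_⟩,
          fun h => (Bool.false_ne_true h.symm).elim⟩
        -- An overflowing knapsack makes the total cost of `insert x S` exceed 1, so its density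
        -- bound gives ρ ≤ f(S ∪ {x}).
        push Not at hfit
        obtain ⟨i, hi⟩ := hfit
        have h1 : (1 : ℝ) ≤ ∑ e ∈ insert x S, totalCost c e :=
          hi.le.trans (Finset.sum_le_sum fun e _ =>
            Finset.single_le_sum (f := fun i => c i e) (fun j _ => hc j e) (Finset.mem_univ i))
        have h2 := hS.density_insert hx
        have h3 := hf.union_le h0 S {x}
        rw [Finset.union_comm, ← Finset.insert_eq] at h3
        have h4 := mul_le_mul_of_nonneg_left h1 hρ
        show ρ ≤ f S + f {x}
        linarith

end QueryProg

end Greedy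

/-! ### Repeated greedy on disjoint ground sets. -/

namespace QueryProg

section Repeated

variable {E : Type} [DecidableEq E] {d : ℕ}

/-- Run the density greedy algorithm `k` times, each time on the elements that have not been used
before, and maximize over the subsets of each of its outputs. The best feasible set seen so far is
kept; the second component of the output tells whether some run was stopped by a knapsack. -/
noncomputable def repeatedGreedy (c : Fin d → E → ℝ) (ρ : ℝ) :
    ℕ → Finset E → Finset E → QueryProg E (Finset E × Bool)
  | 0, _, B => ret (B, false)
  | k + 1, A, B =>
    (densityGreedy c ρ A A.card ∅).bind fun o =>
    (best {B, o.1}).bind fun B₁ =>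
    if o.2 = true then ret (B₁, true) else
    (doubleGreedy o.1).bind fun U =>
    (best {B₁, U}).bind fun B₂ =>
    repeatedGreedy c ρ k (A \ o.1) B₂

/-- A bound for the number of queries of one round of the repeated greedy algorithm, on a ground
set of size `n` with feasible sets of size at most `r`. -/
def roundCost (n r : ℕ) : ℕ := (2 * n + 1) * (r + 1) + (2 + (4 * r * r + 6 * r + 1 + 2))

variable {p : ℕ} {f : Finset E → ℝ} {Indep : Finset E → Prop} {c : Fin d → E → ℝ} {ρ : ℝ}

theorem yields_best_pair (B C : Finset E) :
    (best {B, C}).Yields f Indep 2 fun S => (S = B ∨ S = C) ∧ f B ≤ f S ∧ f C ≤ f S :=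
  (yields_best ⟨B, by simp⟩).mono Finset.card_le_two fun S hS =>
    ⟨by simpa using hS.1, hS.2 B (by simp), hS.2 C (by simp)⟩

/-- Since S and U are disjoint, (S ∪ T) ∩ (T ∪ U) = T, and submodularity produces one extra copy of
f(T). Replacing T by T \ S in the k copies of f costs f(S ∩ T) ≤ 2M each, and these costs accumulate
to k(k-1)M. -/
theorem repeated_bound_step (hf : IsSubmodular f) (h0 : ∀ S, 0 ≤ f S) {S U T : Finset E}
    (hSU : Disjoint S U) {k : ℕ} (hk : k = 0 → U = ∅) {M X : ℝ}
    (hX : f (S ∪ T) ≤ X)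
    (hST : f (S ∩ T) ≤ 2 * M)
    (hU : ((k : ℝ) - 1) * f (T \ S) + f (T \ S ∪ U) ≤ k * X + k * (k - 1) * M) :
    (((k + 1 : ℕ) : ℝ) - 1) * f T + f (T ∪ (S ∪ U)) ≤
      (k + 1 : ℕ) * X + (k + 1 : ℕ) * ((k + 1 : ℕ) - 1) * M := by
  have h1 : f T ≤ f (T \ S) + f (S ∩ T) := by
    have := hf.union_le h0 (T \ S) (S ∩ T)
    rwa [Finset.inter_comm, Finset.sdiff_union_inter, Finset.inter_comm] at this
  have h2 : f (T ∪ U) ≤ f (T \ S ∪ U) + f (S ∩ T) := by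
    have := hf.union_le h0 (T \ S ∪ U) (S ∩ T)
    rwa [Finset.union_right_comm, Finset.inter_comm, Finset.sdiff_union_inter,
      Finset.inter_comm] at this
  have h3 : f (T ∪ (S ∪ U)) + f T ≤ f (S ∪ T) + f (T ∪ U) := by
    have h := hf (S ∪ T) (T ∪ U)
    have e1 : (S ∪ T) ∪ (T ∪ U) = T ∪ (S ∪ U) := by ext y; simp; tauto
    have e2 : (S ∪ T) ∩ (T ∪ U) = T := by
      ext y
      have : y ∈ S → y ∉ U := fun h => Finset.disjoint_left.1 hSU h
      simp only [Finset.mem_inter, Finset.mem_union]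
      tauto
    rwa [e1, e2] at h
  push_cast
  rcases Nat.eq_zero_or_pos k with h | hk
  · rw [hk h, Finset.union_empty, Finset.union_comm, h]
    simpa using hX
  · have hk1 : (0 : ℝ) ≤ (k : ℝ) - 1 := by
      have : (1 : ℝ) ≤ k := by exact_mod_cast hk
      linarith
    have h4 : ((k : ℝ) - 1) * f T ≤ ((k : ℝ) - 1) * (f (T \ S) + 2 * M) :=
      mul_le_mul_of_nonneg_left (by linarith) hk1
    linarith

/-- What the repeated greedy algorithm with `k` rounds guarantees for its output, when it is started
with the feasible set `B`. -/
def RepeatedOutput (p : ℕ) (f : Finset E → ℝ) (Indep : Finset E → Prop) (c : Fin d → E → ℝ) (ρ : ℝ)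
    (k : ℕ) (A B : Finset E) (o : Finset E × Bool) : Prop :=
  IsFeasible Indep c o.1 ∧ f B ≤ f o.1 ∧ (o.2 = true → ρ ≤ 2 * f o.1) ∧
    (o.2 = false → ∃ U ⊆ A, (k = 0 → U = ∅) ∧ ∀ T ⊆ A, IsFeasible Indep c T →
      ((k : ℝ) - 1) * f T + f (T ∪ U) ≤
        k * (((p : ℝ) + 1) * f o.1 + d * ρ) + k * (k - 1) * f o.1)

theorem yields_repeatedGreedy [Finite E] (hf : IsSubmodular f) (h0 : ∀ S, 0 ≤ f S)
    (hI : IsPSystem p Indep) (hc : ∀ i e, 0 ≤ c i e) (hρ : 0 ≤ ρ) {r n : ℕ}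
    (hr : ∀ T, IsFeasible Indep c T → T.card ≤ r) (k : ℕ) :
    ∀ A B : Finset E, A.card ≤ n → IsFeasible Indep c B → (∀ x ∈ A, Indep {x} → f {x} ≤ f B) →
      (repeatedGreedy c ρ k A B).Yields f Indep (k * roundCost n r)
        (RepeatedOutput p f Indep c ρ k A B) := by
  induction k with
  | zero =>
    intro A B _ hB _
    refine ⟨hB, le_rfl, fun h => (Bool.false_ne_true h).elim, fun _ => ⟨∅, by simp, by simp, ?_⟩⟩
    intro T _ _
    simp
  | succ k ih =>
    intro A B hA hB hAB
    have hcost : (2 * n + 1) * (r + 1) + (2 + (4 * r * r + 6 * r + 1 + (2 + k * roundCost n r))) =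
        (k + 1) * roundCost n r := by
      unfold roundCost; ring
    rw [← hcost]
    refine ((yields_densityGreedy hf h0 hI hc hρ hr A.card ∅ (greedyInvariant_empty h0 hI)
      (by simp)).mono (by rw [Finset.card_empty]; gcongr; omega) fun _ => id).bind fun o ho => ?_
    obtain ⟨hoA, hof, hot, hoF⟩ := ho
    refine (yields_best_pair B o.1).bind fun B₁ ⟨hB₁, hBB₁, hoB₁⟩ => ?_
    have hB₁f : IsFeasible Indep c B₁ := by rcases hB₁ with rfl | rfl <;> assumption
    split_ifs with hflag
    · refine ⟨hB₁f, hBB₁, fun _ => ?_, fun h => (Bool.false_ne_true h.symm).elim⟩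
      obtain ⟨x, hxA, hx, hxρ⟩ := hot hflag
      have := hAB x hxA hx
      show ρ ≤ 2 * f B₁
      linarith
    have hflag : o.2 = false := by simpa using hflag
    have hor := hr _ hof
    refine ((yields_doubleGreedy hf h0 o.1).mono (k' := 4 * r * r + 6 * r + 1)
      (by gcongr) fun _ => id).bind fun U ⟨hUo, hU⟩ => ?_
    refine (yields_best_pair B₁ U).bind fun B₂ ⟨hB₂, hB₁₂, hUB₂⟩ => ?_
    have hB₂f : IsFeasible Indep c B₂ := by
      rcases hB₂ with rfl | rfl
      · exact hB₁f
      · exact hof.subset hI hc hUo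
    refine (ih (A \ o.1) B₂ ((Finset.card_le_card Finset.sdiff_subset).trans hA) hB₂f
      fun x hx hxi => ?_).mono le_rfl ?_
    · linarith [hAB x (Finset.mem_sdiff.1 hx).1 hxi]
    rintro q ⟨hqf, hqB, hqt, hqF⟩
    refine ⟨hqf, by linarith, hqt, fun hq => ?_⟩
    obtain ⟨V, hVA, hk, hV⟩ := hqF hq
    refine ⟨o.1 ∪ V, Finset.union_subset hoA (hVA.trans Finset.sdiff_subset), by simp, ?_⟩
    intro T hTA hT
    refine repeated_bound_step hf h0
      (Finset.disjoint_left.2 fun y hy hyV => (Finset.mem_sdiff.1 (hVA hyV)).2 hy) hk ?_ ?_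
      (hV (T \ o.1) (Finset.sdiff_subset_sdiff hTA le_rfl) (hT.subset hI hc Finset.sdiff_subset))
    · have h1 := hoF hflag T hTA hT
      have h2 : ((p : ℝ) + 1) * f o.1 ≤ ((p : ℝ) + 1) * f q.1 :=
        mul_le_mul_of_nonneg_left (by linarith) (by positivity)
      linarith
    · linarith [hU (o.1 ∩ T) Finset.inter_subset_left]

end Repeated

/-- The bound on the optimum that follows from a run of the repeated greedy algorithm with threshold
`σ` that no knapsack stops, when `M` is the best value found. -/
def OptBound {E : Type} {d : ℕ} (p : ℕ) (f : Finset E → ℝ) (Indep : Finset E → Prop) (c : Fin d → E → ℝ)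
    (σ M : ℝ) : Prop :=
  ∀ T, IsFeasible Indep c T → (p : ℝ) * f T ≤ (p + 1) * ((2 * p + 1) * M + d * σ)

theorem OptBound.mono {E : Type} {d p : ℕ} {f : Finset E → ℝ} {Indep : Finset E → Prop}
    {c : Fin d → E → ℝ} {σ M M' : ℝ} (h : OptBound p f Indep c σ M) (hM : M ≤ M') :
    OptBound p f Indep c σ M' := fun T hT => (h T hT).trans (by gcongr)

/-! ### Binary search for the threshold. -/

section Search

variable {E : Type} [DecidableEq E] {d : ℕ}

/-- Binary search for a density threshold in the geometric progression that starts at `ρ`, has ratio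
`1 + ε` and has `2 ^ L` steps. -/
noncomputable def thresholdSearch (c : Fin d → E → ℝ) (p : ℕ) (ε : ℝ) (A : Finset E) :
    ℕ → ℝ → Finset E → QueryProg E (Finset E)
  | 0, _, B => ret B
  | L + 1, ρ, B =>
    (repeatedGreedy c (ρ * (1 + ε) ^ 2 ^ L) (p + 1) A B).bind fun o =>
    thresholdSearch c p ε A L (if o.2 = true then ρ * (1 + ε) ^ 2 ^ L else ρ) o.1

open Classical in
/-- The whole algorithm for the ground set `E`, with `2 ^ L` steps in the grid of thresholds. -/
noncomputable def maximize [Fintype E] (c : Fin d → E → ℝ) (p : ℕ) (ε : ℝ) (L : ℕ) :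
    QueryProg E (Finset E) :=
  let A := (Finset.univ : Finset E).filter fun e => ∀ i, c i e ≤ 1
  (askIndep (A.image singleton)).bind fun J =>
  (best (insert ∅ ((A.filter fun e => J {e} = true).image singleton))).bind fun B =>
  (askValues {B}).bind fun g =>
  (repeatedGreedy c (2 * g B * (1 + ε) ^ 2 ^ L) (p + 1) A B).bind fun o =>
  if o.2 = true then ret o.1 else thresholdSearch c p ε A L (2 * g B) o.1

variable {p : ℕ} {f : Finset E → ℝ} {Indep : Finset E → Prop} {c : Fin d → E → ℝ} {ρ ε : ℝ}

/-- With p + 1 rounds the coefficient of f(T) is p, and f(T ∪ U) is dropped as nonnegative. -/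
theorem RepeatedOutput.optBound (h0 : ∀ S, 0 ≤ f S) {A B : Finset E}
    (hA : ∀ T, IsFeasible Indep c T → T ⊆ A) {o : Finset E × Bool}
    (h : RepeatedOutput p f Indep c ρ (p + 1) A B o) (ho : o.2 = false) :
    OptBound p f Indep c ρ (f o.1) := by
  intro T hT
  obtain ⟨U, -, -, hU⟩ := h.2.2.2 ho
  have := hU T (hA T hT) hT
  push_cast at this
  nlinarith [h0 (T ∪ U)]

/-- The search keeps ρ ≤ 2 f(B) at the lower end and `OptBound` at the upper end; an overflow moves
the lower end up, otherwise the upper end moves down. At depth 0 the ends differ by a factor 1 + ε.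
-/
theorem yields_thresholdSearch [Finite E] (hf : IsSubmodular f) (h0 : ∀ S, 0 ≤ f S)
    (hI : IsPSystem p Indep) (hc : ∀ i e, 0 ≤ c i e) (hε : 0 ≤ ε) {r n : ℕ}
    (hr : ∀ T, IsFeasible Indep c T → T.card ≤ r) {A : Finset E} (hAn : A.card ≤ n)
    (hA : ∀ T, IsFeasible Indep c T → T ⊆ A) (L : ℕ) :
    ∀ (ρ : ℝ) (B : Finset E), 0 ≤ ρ → IsFeasible Indep c B → (∀ x ∈ A, Indep {x} → f {x} ≤ f B) →
      ρ ≤ 2 * f B → OptBound p f Indep c (ρ * (1 + ε) ^ 2 ^ L) (f B) →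
      (thresholdSearch c p ε A L ρ B).Yields f Indep (L * ((p + 1) * roundCost n r)) fun S =>
        IsFeasible Indep c S ∧ OptBound p f Indep c (2 * f S * (1 + ε)) (f S) := by
  induction L with
  | zero =>
    intro ρ B hρ hB _ hρB hopt
    refine ⟨hB, fun T hT => (hopt T hT).trans ?_⟩
    rw [pow_zero, pow_one]
    gcongr
  | succ L ih =>
    intro ρ B hρ hB hAB hρB hopt
    have hσ : 0 ≤ ρ * (1 + ε) ^ 2 ^ L := by positivity
    rw [show (L + 1) * ((p + 1) * roundCost n r) =
      (p + 1) * roundCost n r + L * ((p + 1) * roundCost n r) by ring]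
    refine (yields_repeatedGreedy hf h0 hI hc hσ hr (p + 1) A B hAn hB hAB).bind fun o ho => ?_
    have hAo : ∀ x ∈ A, Indep {x} → f {x} ≤ f o.1 := fun x hx hxi => (hAB x hx hxi).trans ho.2.1
    split_ifs with h
    · refine ih _ _ hσ ho.1 hAo (ho.2.2.1 h) ?_
      rw [mul_assoc, ← pow_add, ← two_mul, ← pow_succ']
      exact hopt.mono ho.2.1
    · refine ih _ _ hρ ho.1 hAo (by linarith [ho.2.1]) ?_
      exact ho.optBound h0 hA (by simpa using h)

theorem le_card_mul_of_singleton_le (hf : IsSubmodular f) (h0 : ∀ S, 0 ≤ f S) {m : ℝ}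
    (T : Finset E) (h : ∀ e ∈ T, f {e} ≤ m) : f T ≤ f ∅ + T.card * m := by
  induction T using Finset.induction_on with
  | empty => simp
  | insert a T ha ih =>
    have h1 := hf.union_le h0 {a} T
    rw [← Finset.insert_eq] at h1
    have h2 := ih fun e he => h e (Finset.mem_insert_of_mem he)
    have h3 := h a (Finset.mem_insert_self _ _)
    rw [Finset.card_insert_of_notMem ha]
    push_cast
    linarith

theorem yields_maximize [Fintype E] (hf : IsSubmodular f) (h0 : ∀ S, 0 ≤ f S)
    (hI : IsPSystem p Indep) (hc : ∀ i e, 0 ≤ c i e) (hε : 0 ≤ ε) {r : ℕ}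
    (hr : ∀ T, IsFeasible Indep c T → T.card ≤ r) {L : ℕ}
    (hL : (Fintype.card E : ℝ) + 1 ≤ 2 * (1 + ε) ^ 2 ^ L) :
    (maximize c p ε L).Yields f Indep
      (2 * Fintype.card E + 2 + (L + 1) * ((p + 1) * roundCost (Fintype.card E) r)) fun S =>
        IsFeasible Indep c S ∧ ((∀ T, IsFeasible Indep c T → f T ≤ 2 * f S) ∨
          OptBound p f Indep c (2 * f S * (1 + ε)) (f S)) := by
  classical
  set n := Fintype.card E with hn
  set A := (Finset.univ : Finset E).filter fun e => ∀ i, c i e ≤ 1 with hAdef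
  have hAn : A.card ≤ n := Finset.card_le_univ _
  -- Discarding elements too expensive on their own loses no feasible set and makes every
  -- independent singleton of `A` feasible.
  have hA : ∀ T, IsFeasible Indep c T → T ⊆ A := fun T hT e he =>
    Finset.mem_filter.2 ⟨Finset.mem_univ _, fun i =>
      (Finset.single_le_sum (f := fun e => c i e) (fun e _ => hc i e) he).trans (hT.2 i)⟩
  have hcost : n + (n + 1 + (1 + ((p + 1) * roundCost n r + L * ((p + 1) * roundCost n r)))) =
      2 * n + 2 + (L + 1) * ((p + 1) * roundCost n r) := by ring
  rw [← hcost]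
  refine ((yields_askIndep _).mono (Finset.card_image_le.trans hAn) fun _ => id).bind
    fun J hJ => ?_
  have hJA : ∀ e ∈ A, (J {e} = true ↔ Indep {e}) := fun e he => hJ _ (Finset.mem_image_of_mem _ he)
  refine ((yields_best (Finset.insert_nonempty _ _)).mono ?_ fun _ => id).bind
    fun B ⟨hBmem, hBmax⟩ => ?_
  · refine (Finset.card_insert_le _ _).trans (Nat.succ_le_succ (Finset.card_image_le.trans ?_))
    exact (Finset.card_filter_le _ _).trans hAn
  have hB : IsFeasible Indep c B := by
    rcases Finset.mem_insert.1 hBmem with rfl | h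
    · exact ⟨hI.empty, fun i => by simp⟩
    · obtain ⟨e, he, rfl⟩ := Finset.mem_image.1 h
      obtain ⟨heA, heJ⟩ := Finset.mem_filter.1 he
      exact ⟨(hJA e heA).1 heJ, fun i => by simpa using (Finset.mem_filter.1 heA).2 i⟩
  have hAB : ∀ x ∈ A, Indep {x} → f {x} ≤ f B := fun x hx hxi =>
    hBmax _ (Finset.mem_insert_of_mem
      (Finset.mem_image_of_mem _ (Finset.mem_filter.2 ⟨hx, (hJA x hx).2 hxi⟩)))
  have hB0 : f ∅ ≤ f B := hBmax _ (Finset.mem_insert_self _ _)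
  refine ((yields_askValues {B}).mono (k' := 1) (by simp) fun _ => id).bind fun g hg => ?_
  rw [hg B (by simp)]
  have hfB := h0 B
  have hσ : 0 ≤ 2 * f B * (1 + ε) ^ 2 ^ L := by positivity
  refine (yields_repeatedGreedy hf h0 hI hc hσ hr (p + 1) A B hAn hB hAB).bind fun o ho => ?_
  split_ifs with h
  · refine ⟨ho.1, Or.inl fun T hT => ?_⟩
    -- An overflow at the top threshold, which is at least (n+1) f(B), already suffices: every
    -- feasible value is at most (n+1) f(B), hence at most 2M.
    have h1 := le_card_mul_of_singleton_le hf h0 T (m := f B) fun e he =>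
      hAB e (hA T hT he) (hI.subset _ _ hT.1 (by simpa using he))
    have h2 : (T.card : ℝ) ≤ n := by exact_mod_cast Finset.card_le_univ T
    have h3 := ho.2.2.1 h
    have h4 := mul_le_mul_of_nonneg_right h2 hfB
    have h5 := mul_le_mul_of_nonneg_right hL hfB
    linarith
  · refine (yields_thresholdSearch hf h0 hI hc hε hr hAn hA L (2 * f B) o.1 (by positivity) ho.1
      (fun x hx hxi => (hAB x hx hxi).trans ho.2.1) (by linarith [ho.2.1])
      (ho.optBound h0 hA (by simpa using h))).mono le_rfl fun S hS => ⟨hS.1, Or.inr hS.2⟩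

end Search

end QueryProg

/-! ### Numerical estimates and the final assembly. -/

theorem card_le_maxFeasibleCard {E : Type} [Fintype E] {d : ℕ} {Indep : Finset E → Prop}
    {c : Fin d → E → ℝ} {T : Finset E} (hT : IsFeasible Indep c T) :
    T.card ≤ maxFeasibleCard Indep c := by
  classical
  unfold maxFeasibleCard
  exact Finset.le_sup (f := Finset.card) (Finset.mem_filter.2 ⟨Finset.mem_univ _, hT⟩)

theorem maxFeasibleCard_le {E : Type} [Fintype E] {d : ℕ} (Indep : Finset E → Prop)
    (c : Fin d → E → ℝ) : maxFeasibleCard Indep c ≤ Fintype.card E := by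
  unfold maxFeasibleCard
  exact Finset.sup_le fun T _ => Finset.card_le_univ T

/-- The number of binary search steps for the precision `ε` and a ground set of size `n`. -/
noncomputable def searchDepth (n : ℕ) (ε : ℝ) : ℕ := ⌈Real.logb 2 (2 * Real.log n / ε)⌉₊

theorem le_pow_searchDepth {n : ℕ} (hn : 1 ≤ n) {ε : ℝ} (h0 : 0 < ε) (h1 : ε < 1) :
    (n : ℝ) ≤ (1 + ε) ^ 2 ^ searchDepth n ε := by
  rcases hn.eq_or_lt with rfl | hn
  · simpa using one_le_pow₀ (by linarith : (1 : ℝ) ≤ 1 + ε)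
  have hn1 : (1 : ℝ) < n := by exact_mod_cast hn
  have hlog : 0 < Real.log n := Real.log_pos hn1
  have hx : 0 < 2 * Real.log n / ε := by positivity
  have hpow : 2 * Real.log n / ε ≤ 2 ^ searchDepth n ε := by
    have := Nat.le_ceil (Real.logb 2 (2 * Real.log n / ε))
    rw [Real.logb_le_iff_le_rpow (by norm_num) hx, Real.rpow_natCast] at this
    exact this
  -- This is what puts the factor 2 into `searchDepth`.
  have hε : ε / 2 ≤ Real.log (1 + ε) := by
    have h := Real.one_sub_inv_le_log_of_pos (by linarith : 0 < 1 + ε)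
    refine le_trans ?_ h
    have : (1 + ε)⁻¹ ≤ 1 - ε / 2 := by
      rw [inv_le_iff_one_le_mul₀ (by linarith)]
      nlinarith
    linarith
  rw [← Real.log_le_log_iff (by linarith) (by positivity), Real.log_pow]
  push_cast
  rw [div_le_iff₀ h0] at hpow
  have := mul_le_mul_of_nonneg_left hε (by positivity : (0 : ℝ) ≤ 2 ^ searchDepth n ε)
  linarith

/-- For ε < 1/6 the maximum W is at least 1, so it absorbs constants; as 2 / log 2 < 3, the depth
plus one is at most 3 + 3W ≤ 6W. -/
theorem searchDepth_add_one_le {n : ℕ} (hn : 1 ≤ n) {ε : ℝ} (h0 : 0 < ε) (h1 : ε < 1 / 6) :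
    (searchDepth n ε : ℝ) + 1 ≤ 6 * max (Real.log (1 / ε)) (Real.log (Real.log n)) := by
  set W := max (Real.log (1 / ε)) (Real.log (Real.log n)) with hW
  have hW1 : 1 ≤ W := by
    refine le_trans ?_ (le_max_left _ _)
    rw [Real.le_log_iff_exp_le (by positivity), le_div_iff₀ h0]
    nlinarith [Real.exp_one_lt_d9, Real.exp_pos 1]
  rcases hn.eq_or_lt with rfl | hn
  · have : searchDepth 1 ε = 0 := by simp [searchDepth]
    rw [this]
    push_cast
    linarith
  have hn2 : (2 : ℝ) ≤ n := by exact_mod_cast hn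
  have hlog2 : 0.6931471803 < Real.log 2 := Real.log_two_gt_d9
  have hlog : Real.log 2 ≤ Real.log n := Real.log_le_log (by norm_num) hn2
  have hx1 : 1 ≤ 2 * Real.log n / ε := by
    rw [le_div_iff₀ h0]; linarith
  have hlogx : Real.log (2 * Real.log n / ε) =
      Real.log 2 + Real.log (Real.log n) + Real.log (1 / ε) := by
    have hpos : 0 < Real.log n := by linarith
    rw [← Real.log_mul (by norm_num) hpos.ne', ← Real.log_mul (by positivity) (by positivity),
      mul_one_div]
  have hceil := Nat.ceil_lt_add_one (Real.logb_nonneg (by norm_num : (1 : ℝ) < 2) hx1)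
  have hle : Real.logb 2 (2 * Real.log n / ε) ≤ 1 + 3 * W := by
    rw [Real.logb, div_le_iff₀ (by linarith), hlogx]
    have h2 : Real.log (1 / ε) ≤ W := le_max_left _ _
    have h3 : Real.log (Real.log n) ≤ W := le_max_right _ _
    nlinarith
  unfold searchDepth
  linarith

theorem ratio_le {p d : ℕ} (hp : 1 ≤ p) :
    (p : ℝ) / (((p : ℝ) + 1) * (2 * (p : ℝ) + 2 * (d : ℝ) + 1)) ≤ 1 / 6 := by
  have hp' : (1 : ℝ) ≤ p := by exact_mod_cast hp
  have hd : (0 : ℝ) ≤ d := Nat.cast_nonneg d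
  rw [div_le_div_iff₀ (by positivity) (by norm_num)]
  nlinarith [mul_nonneg (by linarith : (0 : ℝ) ≤ p - 1) (by linarith : (0 : ℝ) ≤ 2 * p - 1),
    mul_nonneg (by linarith : (0 : ℝ) ≤ p + 1) hd]

/-- The bound gives ratio · F ≤ M(1 + ε), and when M ≤ F the excess Mε is at most εF. -/
theorem ratio_mul_le_of_optBound {p d : ℕ} (hp : 1 ≤ p) {ε F M : ℝ} (hε : 0 < ε) (hF : 0 ≤ F)
    (hM : 0 ≤ M)
    (h : (p : ℝ) * F ≤ (p + 1) * ((2 * p + 1) * M + d * (2 * M * (1 + ε)))) :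
    ((p : ℝ) / (((p : ℝ) + 1) * (2 * (p : ℝ) + 2 * (d : ℝ) + 1)) - ε) * F ≤ M := by
  have hq := ratio_le (d := d) hp
  set D : ℝ := ((p : ℝ) + 1) * (2 * (p : ℝ) + 2 * (d : ℝ) + 1) with hD
  have hD0 : 0 < D := by positivity
  rcases le_total F M with hFM | hMF
  · nlinarith
  have h1 : (p : ℝ) / D * F ≤ M * (1 + ε) := by
    rw [div_mul_eq_mul_div, div_le_iff₀ hD0]
    refine h.trans ?_
    have : 0 ≤ ((p : ℝ) + 1) * (2 * p + 1) * (M * ε) := by positivity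
    rw [hD]
    linarith
  nlinarith

theorem maximize_cost_le {n r p : ℕ} (hn : 1 ≤ n) (hp : 1 ≤ p) (hr : r ≤ n) (L : ℕ) :
    2 * n + 2 + (L + 1) * ((p + 1) * QueryProg.roundCost n r) ≤
      (L + 1) * (50 * (n * max r 1 * p)) := by
  set R := max r 1
  have hR1 : 1 ≤ R := le_max_right _ _
  have hrR : r ≤ R := le_max_left _ _
  have hnR : n ≤ n * R := Nat.le_mul_of_pos_right n hR1
  have hRn : R ≤ n * R := Nat.le_mul_of_pos_left R hn
  have hround : QueryProg.roundCost n r ≤ 23 * (n * R) := by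
    unfold QueryProg.roundCost
    have h1 : r * r ≤ n * R := Nat.mul_le_mul hr hrR
    have h2 : n * r ≤ n * R := Nat.mul_le_mul_left n hrR
    have : (2 * n + 1) * (r + 1) + (2 + (4 * r * r + 6 * r + 1 + 2)) =
      2 * (n * r) + 2 * n + 4 * (r * r) + 7 * r + 6 := by ring
    omega
  have h1 : (p + 1) * QueryProg.roundCost n r ≤ (2 * p) * (23 * (n * R)) :=
    Nat.mul_le_mul (by omega) hround
  have h2 : n * R ≤ n * R * p := Nat.le_mul_of_pos_right _ hp
  have h3 : 2 * n + 2 ≤ (L + 1) * (4 * (n * R * p)) :=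
    (by omega : 2 * n + 2 ≤ 4 * (n * R * p)).trans (Nat.le_mul_of_pos_left _ (by omega))
  calc 2 * n + 2 + (L + 1) * ((p + 1) * QueryProg.roundCost n r)
      ≤ (L + 1) * (4 * (n * R * p)) + (L + 1) * ((2 * p) * (23 * (n * R))) :=
        Nat.add_le_add h3 (Nat.mul_le_mul_left _ h1)
    _ = (L + 1) * (50 * (n * R * p)) := by ring

theorem mainTheorem7 :
    ∃ (alg : ∀ n d : ℕ, ℕ → (Fin d → Fin n → ℝ) → ℝ → OracleAlg (Fin n)) (K : ℝ),
      ∀ (n d p : ℕ) (c : Fin d → Fin n → ℝ) (ε : ℝ),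
        1 ≤ p → (∀ i e, 0 ≤ c i e) → 0 < ε → ε < 1 →
        ∀ (f : Finset (Fin n) → ℝ) (Indep : Finset (Fin n) → Prop),
          (∀ S, 0 ≤ f S) → IsSubmodular f → IsPSystem p Indep →
          IsFeasible Indep c ((alg n d p c ε).result f Indep) ∧
          (∀ T : Finset (Fin n), IsFeasible Indep c T →
            ((p : ℝ) / (((p : ℝ) + 1) * (2 * (p : ℝ) + 2 * (d : ℝ) + 1)) - ε) * f T ≤
              f ((alg n d p c ε).result f Indep)) ∧
          ((alg n d p c ε).queryCount f Indep : ℝ) ≤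
            K * ((n : ℝ) * (max (maxFeasibleCard Indep c) 1 : ℕ) * (p : ℝ) *
              max (Real.log (1 / ε)) (Real.log (Real.log (n : ℝ)))) := by
  classical
  -- For ε ≥ 1/6 the guaranteed ratio is at most 0, so ∅ suffices. No query may be spent there, as
  -- log(1/ε) tends to 0 for ε near 1. The constant 300 is 6 from the search depth times 50 from
  -- `maximize_cost_le`.
  refine ⟨fun n d p c ε => if n = 0 ∨ 1 / 6 ≤ ε then .output ∅ else
    (QueryProg.maximize c p ε (searchDepth n ε)).toAlg, 300, ?_⟩
  intro n d p c ε hp hc h0 h1 f Indep hf0 hf hI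
  have hempty : IsFeasible Indep c ∅ := ⟨hI.empty, fun i => by simp⟩
  have hratio := ratio_le (d := d) hp
  by_cases htriv : n = 0 ∨ 1 / 6 ≤ ε
  · simp only [if_pos htriv, OracleAlg.result, OracleAlg.queryCount]
    refine ⟨hempty, fun T _ => ?_, ?_⟩
    · rcases htriv with rfl | hε
      · rw [Subsingleton.elim T ∅]
        nlinarith [hf0 ∅]
      · nlinarith [hf0 ∅, hf0 T]
    · have : 0 ≤ max (Real.log (1 / ε)) (Real.log (Real.log (n : ℝ))) :=
        (Real.log_nonneg (by rw [le_div_iff₀ h0]; linarith)).trans (le_max_left _ _)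
      rw [Nat.cast_zero]
      positivity
  simp only [if_neg htriv]
  push Not at htriv
  obtain ⟨hn0, hε⟩ := htriv
  have hn : 1 ≤ n := Nat.one_le_iff_ne_zero.2 hn0
  have hn' : (1 : ℝ) ≤ n := by exact_mod_cast hn
  have hL := le_pow_searchDepth hn h0 h1
  obtain ⟨⟨hfeas, hopt⟩, hcount⟩ := (QueryProg.yields_maximize hf hf0 hI hc h0.le
    (fun T hT => card_le_maxFeasibleCard hT) (L := searchDepth n ε) (p := p)
    (by rw [Fintype.card_fin]; linarith)).toAlg
  refine ⟨hfeas, fun T hT => ?_, ?_⟩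
  · rcases hopt with h | h
    · nlinarith [h T hT, hf0 T]
    · exact ratio_mul_le_of_optBound hp h0 (hf0 T) (hf0 _) (h T hT)
  · rw [Fintype.card_fin] at hcount
    have hr := maxFeasibleCard_le Indep c
    rw [Fintype.card_fin] at hr
    have h2 := hcount.trans (maximize_cost_le hn hp hr _)
    have h3 := searchDepth_add_one_le hn h0 hε
    set N := n * max (maxFeasibleCard Indep c) 1 * p with hN
    calc _ ≤ (((searchDepth n ε + 1) * (50 * N) : ℕ) : ℝ) := by exact_mod_cast h2
      _ = ((searchDepth n ε : ℝ) + 1) * (50 * N) := by push_cast; ring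
      _ ≤ 6 * max (Real.log (1 / ε)) (Real.log (Real.log n)) * (50 * N) := by gcongr
      _ = _ := by rw [hN]; push_cast; ring
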